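/- Let $d,k\ge 1$ be integers. For real $n>0$, take the points of a Poisson process of intensity $n$ on $[0,1]^d$ (that is, a Poisson distributed number, with mean $n$, of independent points uniformly distributed on $[0,1]^d$), and consider the undirected graph on these points in which every point is joined to each of its $k$ nearest neighbours in the Euclidean distance among the other points (to all other points, if there are at most $k$ of them). Let $X_n$ be the number of connected components of this graph. Then $\mathbb{E} X_n<\infty$ for all $n>0$, and there is a constant $c_{d,k}>0$ such that $$\lim_{n\to\infty}\frac{\mathbb{E}X_n}{n}=c_{d,k}.$$ Moreover, the expected diameter of a connected component is $\lesssim_{d,k} n^{-1/d}$: there is a constant $C_{d,k}>0$, depending only on $d$ and $k$, such that for all $n>0$ $$\mathbb{E}\Big[\frac{1}{X_n}\sum_{K}\operatorname{diam}K\Big]\le C_{d,k}\,n^{-1/d} \qquad\text{and}\qquad \frac{\mathbb{E}\sum_{K}\operatorname{diam}K}{\mathbb{E}X_n}\le C_{d,k}\,n^{-1/d},$$ where the sums are over the connected components $K$ of the graph, $\operatorname{diam}K$ is the Euclidean diameter of the set of points of $K$, and the average $\frac1{X_n}\sum_K\operatorname{diam}K$ is read as $0$ when there are no points. (The first quantity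 is the expected diameter of a component chosen uniformly at random among the components of the sample; the second is the expected total diameter divided by the expected number of components.) -/

import Mathlib

open MeasureTheory ProbabilityTheory Filter Topology
open scoped NNReal ENNReal

noncomputable section

namespace KNN

/-- The uniform distribution on the unit cube `[0,1]^d`, as a measure on Euclidean space `ℝ^d`
(the cube has Lebesgue measure one). -/
def cubeMeasure (d : ℕ) : Measure (EuclideanSpace ℝ (Fin d)) :=
  volume.restrict {x | ∀ i, x i ∈ Set.Icc (0 : ℝ) 1}

/-- A finite sample of points of `ℝ^d`: its size `m` together with the points `p 0, …, p (m-1)`. -/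
abbrev Sample (d : ℕ) : Type := Σ m : ℕ, (Fin m → EuclideanSpace ℝ (Fin d))

/-- The law of the points of a Poisson process of intensity `n` (times Lebesgue measure) on
`[0,1]^d`: the number of points is `m` with probability `exp (-n) * n ^ m / m !`, and given that
there are `m` points, they are independent and uniformly distributed on the cube. -/
def poissonLaw (d : ℕ) (n : ℝ≥0) : Measure (Sample d) :=
  Measure.sum fun m : ℕ =>
    poissonMeasure n {m} •
      (Measure.pi fun _ : Fin m => cubeMeasure d).map
        (fun p : Fin m → EuclideanSpace ℝ (Fin d) => (⟨m, p⟩ : Sample d))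

variable {d : ℕ}

/-- The point with index `j` is one of the `k` nearest neighbours of the point with index `i`:
fewer than `k` of the other points are strictly closer to `p i` than `p j` is. If there are at
most `k` other points, all of them are among the `k` nearest neighbours. -/
def IsNearestNeighbor (k : ℕ) {m : ℕ} (p : Fin m → EuclideanSpace ℝ (Fin d)) (i j : Fin m) :
    Prop :=
  j ≠ i ∧ {l : Fin m | l ≠ i ∧ dist (p i) (p l) < dist (p i) (p j)}.ncard < k

/-- The (undirected) graph in which every point is connected to its `k` nearest neighbours. -/
def graph (k : ℕ) (ω : Sample d) : SimpleGraph (Fin ω.1) where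
  Adj i j := IsNearestNeighbor k ω.2 i j ∨ IsNearestNeighbor k ω.2 j i
  symm := ⟨fun _ _ h => h.symm⟩
  loopless := ⟨fun _ h => h.elim (fun h => h.1 rfl) (fun h => h.1 rfl)⟩

/-- The number of connected components. -/
def numComponents (k : ℕ) (ω : Sample d) : ℕ :=
  Nat.card (graph k ω).ConnectedComponent

/-- The Euclidean diameter of the set of points of a connected component. -/
def componentDiam (k : ℕ) (ω : Sample d) (C : (graph k ω).ConnectedComponent) : ℝ :=
  Metric.diam (ω.2 '' C.supp)

/-- The sum of the diameters of all connected components (of which there are finitely many). -/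
def sumDiam (k : ℕ) (ω : Sample d) : ℝ :=
  ∑ᶠ C : (graph k ω).ConnectedComponent, componentDiam k ω C

/-- The mean diameter of the connected components of a sample, i.e. the expected diameter of a
component that is picked uniformly at random among the components of the sample. It is `0` for the
empty sample. -/
def meanDiam (k : ℕ) (ω : Sample d) : ℝ :=
  sumDiam k ω / numComponents k ω

end KNN

end

/-! Limit. Cut the cube into cells. If a ball around a point stays inside its cell and holds at
least `k` other points, then the point has the same nearest neighbours within the cell as in the
whole sample. Hence the full graph and the disjoint union of the cell graphs differ only in the arcs
that start at the remaining, unsettled points. Almost surely there are no ties, so each such point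
has at most `k` arcs, and an additional edge lowers the number of components by at most one
(`components_block_comparison`). An unsettled point lies outside the shrunken cells, which fill most
of the volume, or it has few points around it; a packing argument bounds the number of the latter by
a constant per cell, however many points there are (`ncard_unsettled_le`). A Poisson process
restricted to a cell and rescaled is a Poisson process on the unit cube of lower intensity, so the
expected number of components is almost additive (`expComponents_comparison`), and dividing by the
intensity gives a Cauchy family (`eventually_close`).

Lower bound. Take a grid whose cubes contain one point on average. A grid cube with `k + 1` points,
surrounded by an empty region and then by a shell of grid cubes with `k + 1` points each, is joined
to nothing outside (`IsSeparated.mem_of_adj`). In disjoint blocks this happens independently, with a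
positive probability that does not depend on the intensity. By Chebyshev's inequality the number of
components is at least `c₁ * n`, except with probability `c₂ / n`
(`exists_measure_numComponents_lt_le`). This makes the limit positive and controls the denominators
of both mean diameters.

Diameters. The diameter of a component is at most twice the sum, over its points, of the distance to
the farthest of the nearest neighbours. Packing bounds the sum of the `d`-th powers of these radii
by a constant, so the total diameter is of order `n ^ (1 - 1/d)` in expectation (`sumDiam_le`,
`integral_sumDiam_le`). Dividing by the number of components gives the rate; on the exceptional
event the mean diameter is at most `√d`, which costs only order `1 / n`. -/

noncomputable section

namespace KNN

/-! ### Counting connected components of finite graphs -/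

section Components

variable {V : Type*}

lemma mem_of_reachable {G : SimpleGraph V} {s : Set V}
    (h : ∀ a ∈ s, ∀ b, G.Adj a b → b ∈ s) {a b : V} (hab : G.Reachable a b) (ha : a ∈ s) :
    b ∈ s := by
  rw [SimpleGraph.reachable_iff_reflTransGen] at hab
  induction hab with
  | refl => exact ha
  | tail _ hbc ih => exact h _ ih _ hbc

/-- Only the components of `u` and `v` can merge. So sending the component of `v` to `none` and
every other component to its image is injective. -/
lemma card_components_le_sup_edge [Finite V] (G : SimpleGraph V) (u v : V) :
    Nat.card G.ConnectedComponent ≤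
      Nat.card (G ⊔ SimpleGraph.edge u v).ConnectedComponent + 1 := by
  classical
  set H := G ⊔ SimpleGraph.edge u v
  have key : ∀ a b, H.Reachable a b → G.Reachable a b ∨
      (G.Reachable a u ∧ G.Reachable v b) ∨ (G.Reachable a v ∧ G.Reachable u b) := by
    intro a b hab
    rw [SimpleGraph.reachable_iff_reflTransGen] at hab
    induction hab with
    | refl => exact Or.inl (SimpleGraph.Reachable.refl _)
    | tail _ hbc ih =>
      rename_i b c _
      rcases hbc with hbc | hbc
      · have hr := hbc.reachable
        rcases ih with h | ⟨h1, h2⟩ | ⟨h1, h2⟩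
        · exact Or.inl (h.trans hr)
        · exact Or.inr (Or.inl ⟨h1, h2.trans hr⟩)
        · exact Or.inr (Or.inr ⟨h1, h2.trans hr⟩)
      · rw [SimpleGraph.edge_adj] at hbc
        rcases hbc.1 with ⟨rfl, rfl⟩ | ⟨rfl, rfl⟩
        · rcases ih with h | ⟨h1, h2⟩ | ⟨h1, h2⟩
          · exact Or.inr (Or.inl ⟨h, .refl _⟩)
          · exact Or.inr (Or.inl ⟨h1, .refl _⟩)
          · exact Or.inl h1
        · rcases ih with h | ⟨h1, h2⟩ | ⟨h1, h2⟩
          · exact Or.inr (Or.inr ⟨h, .refl _⟩)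
          · exact Or.inl h1
          · exact Or.inr (Or.inr ⟨h1, .refl _⟩)
  rw [← Finite.card_option]
  let f : G.ConnectedComponent → Option H.ConnectedComponent := fun C =>
    if C = G.connectedComponentMk v then none
    else some (C.map (SimpleGraph.Hom.ofLE le_sup_left))
  refine Nat.card_le_card_of_injective f fun C D hCD => ?_
  by_cases hC : C = G.connectedComponentMk v <;> by_cases hD : D = G.connectedComponentMk v
  · rw [hC, hD]
  · simp [f, hC, hD] at hCD
  · simp [f, hC, hD] at hCD
  · simp only [f, hC, hD, if_false, Option.some.injEq] at hCD
    induction C using SimpleGraph.ConnectedComponent.ind with | _ a => ?_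
    induction D using SimpleGraph.ConnectedComponent.ind with | _ b => ?_
    rw [SimpleGraph.ConnectedComponent.map_mk, SimpleGraph.ConnectedComponent.map_mk,
      SimpleGraph.ConnectedComponent.eq] at hCD
    rw [SimpleGraph.ConnectedComponent.eq] at hC hD ⊢
    rcases key _ _ hCD with h | ⟨_, h⟩ | ⟨h, _⟩
    · exact h
    · exact absurd h.symm hD
    · exact absurd h hC

lemma card_components_le_of_le [Finite V] {G H : SimpleGraph V} (h : G ≤ H) :
    Nat.card H.ConnectedComponent ≤ Nat.card G.ConnectedComponent :=
  SimpleGraph.ConnectedComponent.card_le_card_of_le h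

/-- Adding edges lowers the number of components by at most the number of added edges. -/
lemma card_components_le_add_card [Finite V] (D : Finset (V × V)) (G H : SimpleGraph V)
    (h : ∀ a b, H.Adj a b → G.Adj a b ∨ (a, b) ∈ D ∨ (b, a) ∈ D) :
    Nat.card G.ConnectedComponent ≤ Nat.card H.ConnectedComponent + D.card := by
  classical
  induction D using Finset.induction_on generalizing G with
  | empty =>
    simp only [Finset.notMem_empty, or_false, Finset.card_empty, add_zero] at h ⊢
    exact card_components_le_of_le h
  | insert e D he ih =>
    obtain ⟨u, v⟩ := e
    have h1 := card_components_le_sup_edge G u v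
    have h2 := ih (G ⊔ SimpleGraph.edge u v) (by
      intro a b hab
      have hne := hab.ne
      have := h a b hab
      simp only [Finset.mem_insert, Prod.mk.injEq] at this
      rw [SimpleGraph.sup_adj, SimpleGraph.edge_adj]
      grind)
    rw [Finset.card_insert_of_notMem he]
    omega

/-- The disjoint union of graphs on disjoint sets of vertices, the other vertices being isolated. -/
def blockGraph {Q : Type*} (S : Q → Set V) (G : ∀ q, SimpleGraph (S q)) : SimpleGraph V where
  Adj v w := ∃ q, ∃ (hv : v ∈ S q) (hw : w ∈ S q), (G q).Adj ⟨v, hv⟩ ⟨w, hw⟩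
  symm := ⟨fun _ _ ⟨q, hv, hw, h⟩ => ⟨q, hw, hv, h.symm⟩⟩
  loopless := ⟨fun _ ⟨_, _, _, h⟩ => h.ne rfl⟩

/-- The inclusion of a block. -/
def blockHom {Q : Type*} (S : Q → Set V) (G : ∀ q, SimpleGraph (S q)) (q : Q) :
    G q →g blockGraph S G where
  toFun := Subtype.val
  map_rel' := fun {a b} h => ⟨q, a.2, b.2, h⟩

/-- Each edge stays inside one block and the blocks are disjoint, so a walk never leaves the block
it starts in, and no two block components merge. -/
lemma sum_card_components_le_blockGraph [Finite V] {Q : Type*} [Fintype Q] (S : Q → Set V)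
    (hS : Pairwise fun q r => Disjoint (S q) (S r)) (G : ∀ q, SimpleGraph (S q)) :
    ∑ q, Nat.card (G q).ConnectedComponent ≤
      Nat.card (blockGraph S G).ConnectedComponent := by
  have key : ∀ q (v : S q) w, (blockGraph S G).Reachable v w →
      ∃ hw : w ∈ S q, (G q).Reachable v ⟨w, hw⟩ := by
    intro q v w h
    rw [SimpleGraph.reachable_iff_reflTransGen] at h
    induction h with
    | refl => exact ⟨v.2, .refl _⟩
    | tail _ hbc ih =>
      obtain ⟨hb, hr⟩ := ih
      obtain ⟨r, hb', hc, hadj⟩ := hbc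
      obtain rfl : q = r := by
        by_contra hne
        exact Set.disjoint_left.1 (hS hne) hb hb'
      exact ⟨hc, hr.trans hadj.reachable⟩
  rw [← Nat.card_sigma]
  refine Nat.card_le_card_of_injective
    (fun x : Σ q, (G q).ConnectedComponent => x.2.map (blockHom S G x.1)) ?_
  rintro ⟨q, C⟩ ⟨r, D⟩ h
  induction C using SimpleGraph.ConnectedComponent.ind with | _ a => ?_
  induction D using SimpleGraph.ConnectedComponent.ind with | _ b => ?_
  simp only [SimpleGraph.ConnectedComponent.map_mk, SimpleGraph.ConnectedComponent.eq] at h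
  obtain ⟨hw, hr⟩ := key q a _ h
  obtain rfl : q = r := by
    by_contra hne
    exact Set.disjoint_left.1 (hS hne) hw b.2
  simp only [Sigma.mk.injEq, heq_eq_eq, true_and, SimpleGraph.ConnectedComponent.eq]
  exact hr

/-- The block components together with the vertices outside all blocks exhaust the components;
overlapping blocks would do no harm here. -/
lemma blockGraph_card_components_le [Finite V] {Q : Type*} [Fintype Q] (S : Q → Set V)
    (G : ∀ q, SimpleGraph (S q)) :
    Nat.card (blockGraph S G).ConnectedComponent ≤
      ∑ q, Nat.card (G q).ConnectedComponent + {v | ∀ q, v ∉ S q}.ncard := by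
  rw [← Nat.card_sigma, ← Nat.card_coe_set_eq, ← Nat.card_sum]
  refine Nat.card_le_card_of_surjective
    (fun x : (Σ q, (G q).ConnectedComponent) ⊕ {v | ∀ q, v ∉ S q} =>
      x.elim (fun y => y.2.map (blockHom S G y.1))
        (fun v => (blockGraph S G).connectedComponentMk v)) ?_
  intro C
  induction C using SimpleGraph.ConnectedComponent.ind with | _ v => ?_
  by_cases h : ∃ q, v ∈ S q
  · obtain ⟨q, hq⟩ := h
    exact ⟨Sum.inl ⟨q, (G q).connectedComponentMk ⟨v, hq⟩⟩, rfl⟩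
  · push Not at h
    exact ⟨Sum.inr ⟨v, h⟩, rfl⟩

/-- Disjoint nonempty sets of vertices that are closed under adjacency lie in different
components. -/
lemma card_le_card_components [Finite V] (G : SimpleGraph V) {Q : Type*} (T : Finset Q)
    (S : Q → Set V) (hS : ∀ q ∈ T, ∀ r ∈ T, q ≠ r → Disjoint (S q) (S r))
    (hne : ∀ q ∈ T, (S q).Nonempty)
    (hcl : ∀ q ∈ T, ∀ a ∈ S q, ∀ b, G.Adj a b → b ∈ S q) :
    T.card ≤ Nat.card G.ConnectedComponent := by
  rw [← Set.ncard_coe_finset T, ← Nat.card_coe_set_eq]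
  refine Nat.card_le_card_of_injective
    (fun q : (T : Set Q) => G.connectedComponentMk (hne q.1 q.2).some) ?_
  intro q r h
  simp only [SimpleGraph.ConnectedComponent.eq] at h
  by_contra hqr
  exact Set.disjoint_left.1 (hS q q.2 r r.2 fun h => hqr (Subtype.ext h))
    (mem_of_reachable (hcl q q.2) h (hne q.1 q.2).some_mem) (hne r.1 r.2).some_mem

end Components

/-! ### The nearest neighbour graph over arbitrary index types, and its locality -/

section Graph

variable {ι κ X Y : Type*} [PseudoMetricSpace X] [PseudoMetricSpace Y]

/-- `j` is one of the `k` nearest neighbours of `i`, for points with arbitrary indices. -/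
def IsNN (k : ℕ) (p : ι → X) (i j : ι) : Prop :=
  j ≠ i ∧ {l : ι | l ≠ i ∧ dist (p i) (p l) < dist (p i) (p j)}.ncard < k

/-- The `k` nearest neighbour graph on points with arbitrary indices. -/
def nnGraph (k : ℕ) (p : ι → X) : SimpleGraph ι where
  Adj i j := IsNN k p i j ∨ IsNN k p j i
  symm := ⟨fun _ _ h => h.symm⟩
  loopless := ⟨fun _ h => h.elim (fun h => h.1 rfl) (fun h => h.1 rfl)⟩

/-- The graph only depends on the comparisons between the distances from the same point. -/
def nnGraphIso (k : ℕ) (e : ι ≃ κ) (p : ι → X) (q : κ → Y)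
    (h : ∀ i j l, dist (q (e i)) (q (e l)) < dist (q (e i)) (q (e j)) ↔
      dist (p i) (p l) < dist (p i) (p j)) : nnGraph k p ≃g nnGraph k q where
  toEquiv := e
  map_rel_iff' := by
    have key : ∀ i j, IsNN k q (e i) (e j) ↔ IsNN k p i j := by
      intro i j
      have : {l : κ | l ≠ e i ∧ dist (q (e i)) (q l) < dist (q (e i)) (q (e j))} =
          e '' {l : ι | l ≠ i ∧ dist (p i) (p l) < dist (p i) (p j)} := by
        ext l
        obtain ⟨l, rfl⟩ := e.surjective l
        simp [h]
      simp only [IsNN, this, Set.ncard_image_of_injective _ e.injective, ne_eq,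
        EmbeddingLike.apply_eq_iff_eq]
    intro i j
    simp [nnGraph, key]

lemma card_components_nnGraph_congr (k : ℕ) (e : ι ≃ κ) (p : ι → X) (q : κ → Y)
    (h : ∀ i j l, dist (q (e i)) (q (e l)) < dist (q (e i)) (q (e j)) ↔
      dist (p i) (p l) < dist (p i) (p j)) :
    Nat.card (nnGraph k p).ConnectedComponent = Nat.card (nnGraph k q).ConnectedComponent :=
  Nat.card_congr (nnGraphIso k e p q h).connectedComponentEquiv

/-- Without ties, every point has at most `k` nearest neighbours. -/
lemma ncard_isNN_le [Finite ι] (k : ℕ) (p : ι → X) (i : ι)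
    (h : ∀ j l, j ≠ i → l ≠ i → j ≠ l → dist (p i) (p j) ≠ dist (p i) (p l)) :
    {j | IsNN k p i j}.ncard ≤ k := by
  rcases {j | IsNN k p i j}.eq_empty_or_nonempty with h0 | hne
  · simp [h0]
  -- For the farthest neighbour `j`, absence of ties makes all other neighbours strictly closer, so
  -- they are among the fewer than `k` points counted for `j`.
  obtain ⟨j, hj, hmax⟩ := Set.exists_max_image _ (fun j => dist (p i) (p j))
    (Set.toFinite {j | IsNN k p i j}) hne
  have hsub : {j | IsNN k p i j} ⊆
      insert j {l : ι | l ≠ i ∧ dist (p i) (p l) < dist (p i) (p j)} := by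
    intro l hl
    rcases eq_or_ne l j with rfl | hlj
    · exact Set.mem_insert _ _
    · exact Set.mem_insert_of_mem _ ⟨hl.1, lt_of_le_of_ne (hmax l hl) (h _ _ hl.1 hj.1 hlj)⟩
  have h1 := Set.ncard_le_ncard hsub (Set.toFinite _)
  have h2 := Set.ncard_insert_le j {l : ι | l ≠ i ∧ dist (p i) (p l) < dist (p i) (p j)}
  have h3 := hj.2
  omega

/-- If at least `k` points are within distance `r`, then the nearest neighbours are, too. -/
lemma IsNN.dist_lt [Finite ι] {k : ℕ} {p : ι → X} {i j : ι} (h : IsNN k p i j) {r : ℝ}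
    (hr : k ≤ {l | l ≠ i ∧ dist (p i) (p l) < r}.ncard) : dist (p i) (p j) < r := by
  by_contra hle
  push Not at hle
  have : {l | l ≠ i ∧ dist (p i) (p l) < r}.ncard ≤
      {l : ι | l ≠ i ∧ dist (p i) (p l) < dist (p i) (p j)}.ncard :=
    Set.ncard_le_ncard (fun l hl => ⟨hl.1, hl.2.trans_le hle⟩) (Set.toFinite _)
  have := h.2
  omega

/-- Nearest neighbours within a block are the same as among all points if there are enough points
of the block within a distance up to which there are only points of the block. -/
lemma isNN_block_iff [Finite ι] {k : ℕ} {p : ι → X} {S : Set ι} {r : ℝ} {i : ι} (hi : i ∈ S)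
    (hS : ∀ j, dist (p i) (p j) < r → j ∈ S)
    (hr : k ≤ {l | l ∈ S ∧ l ≠ i ∧ dist (p i) (p l) < r}.ncard) (j : ι) :
    IsNN k p i j ↔ ∃ hj : j ∈ S, IsNN k (fun l : S => p l) ⟨i, hi⟩ ⟨j, hj⟩ := by
  have himg : ∀ R, Subtype.val ''
      {l : S | l ≠ ⟨i, hi⟩ ∧ dist (p i) (p l) < R} =
      {l | l ∈ S ∧ l ≠ i ∧ dist (p i) (p l) < R} := by
    intro R
    ext l
    simp only [Set.mem_image, Set.mem_ofPred_eq, Subtype.exists, ne_eq, Subtype.mk.injEq,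
      exists_and_left, exists_prop, exists_eq_right_right]
    tauto
  have hcard : ∀ R, {l : S | l ≠ ⟨i, hi⟩ ∧ dist (p i) (p l) < R}.ncard =
      {l | l ∈ S ∧ l ≠ i ∧ dist (p i) (p l) < R}.ncard := fun R => by
    rw [← himg R, Set.ncard_image_of_injective _ Subtype.val_injective]
  -- Up to radius `r` the points of the block are all the points, so the counts that decide about
  -- neighbours agree at every distance up to `r`.
  have heq : ∀ R, R ≤ r → {l | l ∈ S ∧ l ≠ i ∧ dist (p i) (p l) < R} =
      {l | l ≠ i ∧ dist (p i) (p l) < R} := by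
    intro R hR
    ext l
    exact ⟨fun h => h.2, fun h => ⟨hS l (h.2.trans_le hR), h⟩⟩
  constructor
  · intro h
    have hlt : dist (p i) (p j) < r := h.dist_lt (by rwa [heq r le_rfl] at hr)
    refine ⟨hS j hlt, ?_, ?_⟩
    · simpa [Subtype.ext_iff] using h.1
    · have := hcard (dist (p i) (p j))
      rw [heq _ hlt.le] at this
      exact this.trans_lt h.2
  · rintro ⟨hj, h⟩
    have hlt : dist (p i) (p j) < r :=
      IsNN.dist_lt (p := fun l : S => p l) h (by rw [← hcard r] at hr; exact hr)
    refine ⟨by simpa [Subtype.ext_iff] using h.1, ?_⟩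
    have := hcard (dist (p i) (p j))
    rw [heq _ hlt.le] at this
    exact this.symm.trans_lt h.2

end Graph

/-! ### Packing by volume, and the bound on the total diameter -/

section Packing

variable {d : ℕ}

lemma nontrivial_euclideanSpace (hd : 1 ≤ d) : Nontrivial (EuclideanSpace ℝ (Fin d)) := by
  have : Nonempty (Fin d) := ⟨⟨0, hd⟩⟩
  have : Nontrivial (Fin d → ℝ) := inferInstance
  exact (WithLp.equiv 2 (Fin d → ℝ)).nontrivial

/-- Balls of half the radius around the points overlap at most `k` times if each ball of full
radius contains fewer than `k` other points. -/
lemma sum_pow_radius_le (hd : 1 ≤ d) {ι : Type*} [Fintype ι] {k : ℕ}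
    (x : ι → EuclideanSpace ℝ (Fin d)) (r : ι → ℝ) (hr : ∀ i, 0 ≤ r i)
    (h : ∀ i, {l | l ≠ i ∧ dist (x i) (x l) < r i}.ncard < k)
    (c : EuclideanSpace ℝ (Fin d)) {ρ : ℝ} (hρ : 0 ≤ ρ)
    (hU : ∀ i, Metric.ball (x i) (r i / 2) ⊆ Metric.ball c ρ) :
    ∑ i, r i ^ d ≤ k * (2 * ρ) ^ d := by
  classical
  have := nontrivial_euclideanSpace hd
  set b := volume (Metric.ball (0 : EuclideanSpace ℝ (Fin d)) 1) with hb
  have hb0 : b ≠ 0 := (Metric.measure_ball_pos _ _ one_pos).ne'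
  have hbt : b ≠ ⊤ := measure_ball_lt_top.ne
  have hvol : ∀ y : EuclideanSpace ℝ (Fin d), ∀ t : ℝ, 0 ≤ t →
      volume (Metric.ball y t) = ENNReal.ofReal (t ^ d) * b := by
    intro y t ht
    rw [Measure.addHaar_ball volume y ht, finrank_euclideanSpace_fin]
  have hmult : ∀ y, ∑ i, (Metric.ball (x i) (r i / 2)).indicator (1 : EuclideanSpace ℝ (Fin d) → ℝ≥0∞) y ≤
      (Metric.ball c ρ).indicator (fun _ => (k : ℝ≥0∞)) y := by
    intro y
    set T := Finset.univ.filter fun i => y ∈ Metric.ball (x i) (r i / 2) with hT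
    have hsum : ∑ i, (Metric.ball (x i) (r i / 2)).indicator (1 : EuclideanSpace ℝ (Fin d) → ℝ≥0∞) y = T.card := by
      simp [Set.indicator_apply, hT]
    rw [hsum]
    rcases T.eq_empty_or_nonempty with h0 | hne
    · simp [h0]
    -- Take the largest of the half-radius balls that contain `y`. By the triangle inequality the
    -- centres of the others are within `r i` of its centre, so there are fewer than `k` of them.
    obtain ⟨i, hi, hmax⟩ := T.exists_max_image r hne
    have hmem : ∀ l ∈ T, dist y (x l) < r l / 2 := fun l hl => by
      simpa [hT] using hl
    have hyc : y ∈ Metric.ball c ρ := hU i (hmem i hi)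
    rw [Set.indicator_of_mem hyc]
    have h1 : ((T.erase i : Finset ι) : Set ι).ncard ≤
        {l | l ≠ i ∧ dist (x i) (x l) < r i}.ncard := by
      refine Set.ncard_le_ncard (fun l hl => ?_) (Set.toFinite _)
      simp only [Finset.coe_erase, Set.mem_sdiff, Finset.mem_coe, Set.mem_singleton_iff] at hl
      refine ⟨hl.2, ?_⟩
      have h2 := hmem i hi
      have h3 := hmem l hl.1
      have h4 := hmax l hl.1
      have h5 := dist_triangle_left (x i) (x l) y
      linarith
    rw [Set.ncard_coe_finset, Finset.card_erase_of_mem hi] at h1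
    have h2 := h i
    exact_mod_cast (by omega : T.card ≤ k)
  have hle : ∑ i, ENNReal.ofReal ((r i / 2) ^ d) * b ≤ k * (ENNReal.ofReal (ρ ^ d) * b) := by
    calc ∑ i, ENNReal.ofReal ((r i / 2) ^ d) * b
        = ∑ i, ∫⁻ y, (Metric.ball (x i) (r i / 2)).indicator (1 : EuclideanSpace ℝ (Fin d) → ℝ≥0∞) y := by
          refine Finset.sum_congr rfl fun i _ => ?_
          rw [lintegral_indicator_one measurableSet_ball,
            hvol _ _ (by have := hr i; positivity)]
      _ = ∫⁻ y, ∑ i, (Metric.ball (x i) (r i / 2)).indicator (1 : EuclideanSpace ℝ (Fin d) → ℝ≥0∞) y := by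
          rw [lintegral_finsetSum]
          intro i _
          exact measurable_one.indicator measurableSet_ball
      _ ≤ ∫⁻ y, (Metric.ball c ρ).indicator (fun _ => (k : ℝ≥0∞)) y := lintegral_mono hmult
      _ = k * (ENNReal.ofReal (ρ ^ d) * b) := by
          rw [lintegral_indicator_const measurableSet_ball, hvol _ _ hρ]
  rw [← Finset.sum_mul, ← mul_assoc, ENNReal.mul_le_mul_iff_left hb0 hbt,
    ← ENNReal.ofReal_sum_of_nonneg (fun i _ => by have := hr i; positivity),
    ← ENNReal.ofReal_natCast, ← ENNReal.ofReal_mul (by positivity),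
    ENNReal.ofReal_le_ofReal_iff (by positivity)] at hle
  simp_rw [div_pow, ← Finset.sum_div] at hle
  rw [div_le_iff₀ (by positivity)] at hle
  rw [mul_pow]
  linarith

/-- The largest distance to a nearest neighbour, or `0` if there is none. -/
def nnRadius {ι X : Type*} [PseudoMetricSpace X] (k : ℕ) (p : ι → X) (i : ι) : ℝ :=
  ⨆ j : {j // IsNN k p i j}, dist (p i) (p j)

section nnRadius

variable {ι X : Type*} [PseudoMetricSpace X] {k : ℕ} {p : ι → X}

lemma nnRadius_nonneg (i : ι) : 0 ≤ nnRadius k p i :=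
  Real.iSup_nonneg fun _ => dist_nonneg

lemma IsNN.dist_le_nnRadius [Finite ι] {i j : ι} (h : IsNN k p i j) :
    dist (p i) (p j) ≤ nnRadius k p i :=
  le_ciSup (f := fun j : {j // IsNN k p i j} => dist (p i) (p j))
    (Set.finite_range _).bddAbove ⟨j, h⟩

lemma nnRadius_le {i : ι} {D : ℝ} (hD : ∀ i j, dist (p i) (p j) ≤ D) : nnRadius k p i ≤ D :=
  Real.iSup_le (fun j => hD i j) (dist_nonneg.trans (hD i i))

/-- The supremum is attained at a neighbour, whose defining count is the claim. Without neighbours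
the radius is `0` and the set is empty, which is where `1 ≤ k` enters. This makes the radii
admissible in `sum_pow_radius_le`. -/
lemma ncard_lt_nnRadius [Finite ι] (hk : 1 ≤ k) (i : ι) :
    {l | l ≠ i ∧ dist (p i) (p l) < nnRadius k p i}.ncard < k := by
  rcases isEmpty_or_nonempty {j // IsNN k p i j} with h0 | hne
  · have : {l | l ≠ i ∧ dist (p i) (p l) < nnRadius k p i} = ∅ := by
      ext l
      simp [nnRadius, Real.iSup_of_isEmpty, dist_nonneg]
    rw [this, Set.ncard_empty]
    exact hk
  · obtain ⟨j, hj⟩ := exists_eq_ciSup_of_finite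
      (f := fun j : {j // IsNN k p i j} => dist (p i) (p j))
    rw [nnRadius, ← hj]
    exact j.2.2

lemma dist_le_of_adj [Finite ι] {a b : ι} (h : (nnGraph k p).Adj a b) :
    dist (p a) (p b) ≤ nnRadius k p a + nnRadius k p b := by
  have ha := nnRadius_nonneg (k := k) (p := p) a
  have hb := nnRadius_nonneg (k := k) (p := p) b
  rcases h with h | h
  · linarith [h.dist_le_nnRadius]
  · linarith [h.dist_le_nnRadius, dist_comm (p a) (p b)]

/-- An edge is at most as long as the sum of the radii of its ends, and an inner vertex of the walk
lies on two edges. The extra end terms on the left make the induction close. -/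
lemma dist_le_sum_support [Finite ι] {a b : ι} (w : (nnGraph k p).Walk a b) :
    dist (p a) (p b) + nnRadius k p a + nnRadius k p b ≤
      (w.support.map fun v => 2 * nnRadius k p v).sum := by
  induction w with
  | nil => simp; linarith
  | cons h w ih =>
    rename_i a c b
    simp only [SimpleGraph.Walk.support_cons, List.map_cons, List.sum_cons]
    linarith [dist_triangle (p a) (p c) (p b), dist_le_of_adj h]

/-- Two points of the component are joined by a path. A path repeats no vertex, so its radii are
part of the sum over the component. -/
lemma diam_component_le [Fintype ι] (C : (nnGraph k p).ConnectedComponent)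
    [DecidablePred fun i => (nnGraph k p).connectedComponentMk i = C] :
    Metric.diam (p '' C.supp) ≤
      ∑ i with (nnGraph k p).connectedComponentMk i = C, 2 * nnRadius k p i := by
  classical
  refine Metric.diam_le_of_forall_dist_le
    (Finset.sum_nonneg fun i _ => mul_nonneg two_pos.le (nnRadius_nonneg i)) ?_
  rintro _ ⟨a, ha, rfl⟩ _ ⟨b, hb, rfl⟩
  rw [SimpleGraph.ConnectedComponent.mem_supp_iff] at ha hb
  obtain ⟨w, hw⟩ := (SimpleGraph.ConnectedComponent.exact (ha.trans hb.symm)).exists_isPath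
  have h1 := dist_le_sum_support w
  have h2 : (w.support.map fun v => 2 * nnRadius k p v).sum ≤
      ∑ i with (nnGraph k p).connectedComponentMk i = C, 2 * nnRadius k p i := by
    rw [← List.sum_toFinset _ hw.support_nodup]
    refine Finset.sum_le_sum_of_subset_of_nonneg (fun v hv => ?_)
      fun i _ _ => mul_nonneg two_pos.le (nnRadius_nonneg i)
    rw [List.mem_toFinset] at hv
    rw [Finset.mem_filter]
    refine ⟨Finset.mem_univ _, ?_⟩
    rw [← ha, SimpleGraph.ConnectedComponent.eq]
    exact (w.takeUntil v hv).reachable.symm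
  linarith [nnRadius_nonneg (k := k) (p := p) a, nnRadius_nonneg (k := k) (p := p) b]

end nnRadius

lemma sumDiam_eq_sum (k : ℕ) (ω : Sample d) [Fintype (graph k ω).ConnectedComponent] :
    sumDiam k ω = ∑ C, componentDiam k ω C := finsum_eq_sum_of_fintype _

lemma sumDiam_nonneg (k : ℕ) (ω : Sample d) : 0 ≤ sumDiam k ω :=
  finsum_nonneg fun _ => Metric.diam_nonneg

lemma sumDiam_le_sum_nnRadius (k : ℕ) (ω : Sample d) :
    sumDiam k ω ≤ 2 * ∑ i, nnRadius k ω.2 i := by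
  classical
  have : Fintype (graph k ω).ConnectedComponent := Fintype.ofFinite _
  rw [sumDiam_eq_sum, Finset.mul_sum,
    ← Finset.sum_fiberwise Finset.univ fun i => (graph k ω).connectedComponentMk i]
  exact Finset.sum_le_sum fun C _ => diam_component_le (p := ω.2) C

/-- The closed unit cube. -/
def cube (d : ℕ) : Set (EuclideanSpace ℝ (Fin d)) := {x | ∀ i, x i ∈ Set.Icc (0 : ℝ) 1}

lemma dist_le_of_coord_le {x y : EuclideanSpace ℝ (Fin d)} {s : ℝ} (hs : 0 ≤ s)
    (h : ∀ c, |x c - y c| ≤ s) : dist x y ≤ s * √d := by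
  rw [EuclideanSpace.dist_eq, ← Real.sqrt_sq hs, ← Real.sqrt_mul (sq_nonneg s)]
  refine Real.sqrt_le_sqrt ?_
  calc ∑ c, dist (x c) (y c) ^ 2 ≤ ∑ _c : Fin d, s ^ 2 := by
        refine Finset.sum_le_sum fun c _ => ?_
        rw [Real.dist_eq]
        exact pow_le_pow_left₀ (abs_nonneg _) (h c) 2
    _ = s ^ 2 * d := by simp [mul_comm]

lemma dist_le_of_mem_cube {x y : EuclideanSpace ℝ (Fin d)} (hx : x ∈ cube d) (hy : y ∈ cube d) :
    dist x y ≤ √d := by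
  rw [← one_mul (√d)]
  refine dist_le_of_coord_le zero_le_one fun c => ?_
  rw [abs_le]
  constructor <;> linarith [(hx c).1, (hx c).2, (hy c).1, (hy c).2]

lemma componentDiam_le (k : ℕ) (ω : Sample d) (h : ∀ i, ω.2 i ∈ cube d)
    (C : (graph k ω).ConnectedComponent) : componentDiam k ω C ≤ √d := by
  refine Metric.diam_le_of_forall_dist_le (Real.sqrt_nonneg _) ?_
  rintro _ ⟨a, _, rfl⟩ _ ⟨b, _, rfl⟩
  exact dist_le_of_mem_cube (h a) (h b)

lemma sumDiam_le_mul_numComponents (k : ℕ) (ω : Sample d) (h : ∀ i, ω.2 i ∈ cube d) :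
    sumDiam k ω ≤ √d * numComponents k ω := by
  classical
  have : Fintype (graph k ω).ConnectedComponent := Fintype.ofFinite _
  rw [sumDiam_eq_sum, numComponents, Nat.card_eq_fintype_card]
  refine (Finset.sum_le_card_nsmul _ _ _ fun C _ => componentDiam_le k ω h C).trans ?_
  rw [nsmul_eq_mul, mul_comm, Finset.card_univ]

lemma meanDiam_nonneg (k : ℕ) (ω : Sample d) : 0 ≤ meanDiam k ω :=
  div_nonneg (sumDiam_nonneg k ω) (Nat.cast_nonneg _)

lemma meanDiam_le (k : ℕ) (ω : Sample d) (h : ∀ i, ω.2 i ∈ cube d) : meanDiam k ω ≤ √d :=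
  div_le_of_le_mul₀ (Nat.cast_nonneg _) (Real.sqrt_nonneg _) (sumDiam_le_mul_numComponents k ω h)

/-- Packing controls the sum of the `d`-th powers of the radii; a threshold `r` turns this into a
bound on the sum of the radii that is linear in the number of points. The factor `r / r ^ d` stands
for `r ^ (1 - d)`. -/
lemma sumDiam_le (hd : 1 ≤ d) {k : ℕ} (hk : 1 ≤ k) (ω : Sample d) (h : ∀ i, ω.2 i ∈ cube d)
    {r : ℝ} (hr : 0 < r) :
    sumDiam k ω ≤ 2 * (ω.1 * r + k * (4 * √d) ^ d * (r / r ^ d)) := by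
  have hpack : ∑ i, nnRadius k ω.2 i ^ d ≤ k * (2 * (2 * √d)) ^ d := by
    refine sum_pow_radius_le hd ω.2 _ (fun i => nnRadius_nonneg i)
      (fun i => ncard_lt_nnRadius hk i) 0 (by positivity) fun i y hy => ?_
    have h1 : nnRadius k ω.2 i ≤ √d := nnRadius_le fun i j => dist_le_of_mem_cube (h i) (h j)
    have h2 : dist (ω.2 i) 0 ≤ √d := dist_le_of_mem_cube (h i) fun c => by simp
    have h3 : 0 < √(d : ℝ) := Real.sqrt_pos.2 (by exact_mod_cast hd)
    rw [Metric.mem_ball] at hy ⊢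
    linarith [dist_triangle y (ω.2 i) 0]
  -- A radius `R > r` satisfies `R ≤ R * (R / r) ^ (d - 1)`, which is the second summand.
  have hone : ∀ i, nnRadius k ω.2 i ≤ r + nnRadius k ω.2 i ^ d * (r / r ^ d) := by
    intro i
    set R := nnRadius k ω.2 i with hR
    have hR0 : 0 ≤ R := nnRadius_nonneg i
    rcases le_or_gt R r with hle | hlt
    · have : 0 ≤ R ^ d * (r / r ^ d) := by positivity
      linarith
    · obtain ⟨e, rfl⟩ : ∃ e, d = e + 1 := ⟨d - 1, by omega⟩
      have h1 : R ^ (e + 1) * (r / r ^ (e + 1)) = R * (R / r) ^ e := by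
        rw [div_pow]; field_simp; ring
      have h2 : 1 ≤ (R / r) ^ e := one_le_pow₀ ((one_le_div hr).2 hlt.le)
      rw [h1]
      nlinarith
  calc sumDiam k ω ≤ 2 * ∑ i, nnRadius k ω.2 i := sumDiam_le_sum_nnRadius k ω
    _ ≤ 2 * ∑ i, (r + nnRadius k ω.2 i ^ d * (r / r ^ d)) := by
        gcongr with i; exact hone i
    _ = 2 * (ω.1 * r + (∑ i, nnRadius k ω.2 i ^ d) * (r / r ^ d)) := by
        rw [Finset.sum_add_distrib, Finset.sum_mul]; simp
    _ ≤ 2 * (ω.1 * r + k * (2 * (2 * √d)) ^ d * (r / r ^ d)) := by gcongr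
    _ = _ := by ring_nf

end Packing

/-! ### Comparing the full graph with the graphs of the cells -/

section Comparison

variable {d : ℕ}

lemma card_pairs_le {ι : Type*} [Fintype ι] [DecidableEq ι] {k : ℕ} (B : Finset ι)
    (P : ι → ι → Prop) [∀ i, DecidablePred (P i)] (h : ∀ i, {j | P i j}.ncard ≤ k) :
    (B.biUnion fun i => (Finset.univ.filter (P i)).image fun j => (i, j)).card ≤ B.card * k := by
  refine Finset.card_biUnion_le_card_mul _ _ _ fun i _ => Finset.card_image_le.trans ?_
  have := h i
  rwa [← Set.ncard_coe_finset, Finset.coe_filter_univ]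

/-- The points whose nearest neighbours within their block may differ from those among all
points. -/
def unsettled {ι Q X : Type*} [PseudoMetricSpace X] (k : ℕ) (p : ι → X) (A B : Q → Set X)
    (ρ : ℝ) : Set ι :=
  {i | ¬ ∃ q, p i ∈ B q ∧ k ≤ {l | p l ∈ A q ∧ l ≠ i ∧ dist (p i) (p l) < ρ}.ncard}

/-- A settled point has the same neighbours in its block and overall, so each graph is contained in
the other after adding the arcs from unsettled points, at most `k` for each. -/
lemma components_block_comparison {ι Q X : Type*} [PseudoMetricSpace X] [Fintype ι] [Fintype Q]
    (k : ℕ) (p : ι → X) (A B : Q → Set X) {ρ : ℝ} (hρ : 0 < ρ)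
    (hA : Pairwise fun q r => Disjoint (A q) (A r))
    (hBA : ∀ q, ∀ x ∈ B q, Metric.ball x ρ ⊆ A q)
    (htie : ∀ i j l, j ≠ i → l ≠ i → j ≠ l → dist (p i) (p j) ≠ dist (p i) (p l)) :
    Nat.card (nnGraph k p).ConnectedComponent ≤
        ∑ q, Nat.card (nnGraph k fun i : {i | p i ∈ A q} => p i).ConnectedComponent +
          (k + 1) * (unsettled k p A B ρ).ncard ∧
      ∑ q, Nat.card (nnGraph k fun i : {i | p i ∈ A q} => p i).ConnectedComponent ≤
        Nat.card (nnGraph k p).ConnectedComponent + (k + 1) * (unsettled k p A B ρ).ncard := by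
  classical
  set S : Q → Set ι := fun q => {i | p i ∈ A q} with hSdef
  have hS : Pairwise fun q r => Disjoint (S q) (S r) := fun q r hqr =>
    Set.disjoint_left.2 fun i h1 h2 => Set.disjoint_left.1 (hA hqr) h1 h2
  set U := (unsettled k p A B ρ).toFinset with hU
  have hUcard : U.card = (unsettled k p A B ρ).ncard := by
    rw [hU, Set.ncard_eq_toFinset_card']
  set G : ∀ q, SimpleGraph (S q) := fun q => nnGraph k fun i : S q => p i with hG
  have hBS : ∀ i q, p i ∈ B q → i ∈ S q := fun i q h => hBA q _ h (Metric.mem_ball_self hρ)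
  have hiff : ∀ i ∉ U, ∃ q, ∃ hi : i ∈ S q, ∀ j, IsNN k p i j ↔
      ∃ hj : j ∈ S q, IsNN k (fun l : S q => p l) ⟨i, hi⟩ ⟨j, hj⟩ := by
    intro i hi
    rw [hU, Set.mem_toFinset, unsettled, Set.mem_ofPred_eq, not_not] at hi
    obtain ⟨q, hq, hk⟩ := hi
    exact ⟨q, hBS i q hq, isNN_block_iff (hBS i q hq)
      (fun j hj => hBA q _ hq (by rwa [Metric.mem_ball, dist_comm])) hk⟩
  -- `P` is the directed neighbour relation inside the blocks; it agrees with `IsNN k p` at settled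
  -- starting points.
  set P : ι → ι → Prop := fun i j => ∃ q, ∃ (hi : i ∈ S q) (hj : j ∈ S q),
    IsNN k (fun l : S q => p l) ⟨i, hi⟩ ⟨j, hj⟩ with hP
  have hPcard : ∀ i, {j | P i j}.ncard ≤ k := by
    intro i
    by_cases hi : ∃ q, i ∈ S q
    · obtain ⟨q, hi⟩ := hi
      have hsub : {j | P i j} ⊆
          Subtype.val '' {j | IsNN k (fun l : S q => p l) ⟨i, hi⟩ j} := by
        rintro j ⟨r, hi', hj, h⟩
        obtain rfl : q = r := by
          by_contra hne
          exact Set.disjoint_left.1 (hS hne) hi hi'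
        exact ⟨⟨j, hj⟩, h, rfl⟩
      refine (Set.ncard_le_ncard hsub (Set.toFinite _)).trans
        ((Set.ncard_image_le (Set.toFinite _)).trans (ncard_isNN_le k _ _ ?_))
      intro j l hj hl hjl
      exact htie i j l (fun h => hj (Subtype.ext h)) (fun h => hl (Subtype.ext h))
        (fun h => hjl (Subtype.ext h))
    · have : {j | P i j} = ∅ := by
        ext j
        simp only [Set.mem_ofPred_eq, Set.mem_empty_iff_false, iff_false]
        rintro ⟨q, h, _⟩
        exact hi ⟨q, h⟩
      simp [this]
  -- `D₁` collects the block arcs and `D₂` the arcs of the full graph that start at unsettled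
  -- points: the edges to be added in the two directions of the comparison.
  set D₁ := U.biUnion fun i => (Finset.univ.filter (P i)).image fun j => (i, j) with hD₁
  set D₂ := U.biUnion fun i => (Finset.univ.filter (IsNN k p i)).image fun j => (i, j) with hD₂
  have hD₁card : D₁.card ≤ U.card * k := card_pairs_le U P hPcard
  have hD₂card : D₂.card ≤ U.card * k := card_pairs_le U (IsNN k p)
    fun i => ncard_isNN_le k p i (htie i)
  have hD₁mem : ∀ i j, i ∈ U → P i j → (i, j) ∈ D₁ := fun i j hi h =>
    Finset.mem_biUnion.2 ⟨i, hi, Finset.mem_image.2 ⟨j, by simpa using h, rfl⟩⟩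
  have hD₂mem : ∀ i j, i ∈ U → IsNN k p i j → (i, j) ∈ D₂ := fun i j hi h =>
    Finset.mem_biUnion.2 ⟨i, hi, Finset.mem_image.2 ⟨j, by simpa using h, rfl⟩⟩
  have hPadj : ∀ i j, P i j → (blockGraph S G).Adj i j := fun i j ⟨q, hi, hj, h⟩ =>
    ⟨q, hi, hj, Or.inl h⟩
  have hNN : ∀ i ∉ U, ∀ j, IsNN k p i j → P i j := by
    intro i hi j h
    obtain ⟨q, hiq, hq⟩ := hiff i hi
    obtain ⟨hj, hj'⟩ := (hq j).1 h
    exact ⟨q, hiq, hj, hj'⟩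
  have hNN' : ∀ i ∉ U, ∀ j, P i j → IsNN k p i j := by
    rintro i hi j ⟨r, hir, hj, h⟩
    obtain ⟨q, hiq, hq⟩ := hiff i hi
    obtain rfl : q = r := by
      by_contra hne
      exact Set.disjoint_left.1 (hS hne) hiq hir
    exact (hq j).2 ⟨hj, h⟩
  have h1 : Nat.card (blockGraph S G).ConnectedComponent ≤
      Nat.card (nnGraph k p).ConnectedComponent + D₂.card := by
    refine card_components_le_add_card D₂ _ _ ?_
    rintro a b (h | h)
    · by_cases ha : a ∈ U
      · exact Or.inr (Or.inl (hD₂mem a b ha h))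
      · exact Or.inl (hPadj _ _ (hNN a ha b h))
    · by_cases hb : b ∈ U
      · exact Or.inr (Or.inr (hD₂mem b a hb h))
      · exact Or.inl (hPadj _ _ (hNN b hb a h)).symm
  have h2 : Nat.card (nnGraph k p).ConnectedComponent ≤
      Nat.card (blockGraph S G).ConnectedComponent + D₁.card := by
    refine card_components_le_add_card D₁ _ _ ?_
    rintro a b ⟨q, ha, hb, h | h⟩
    · have hab : P a b := ⟨q, ha, hb, h⟩
      by_cases haU : a ∈ U
      · exact Or.inr (Or.inl (hD₁mem a b haU hab))
      · exact Or.inl (Or.inl (hNN' a haU b hab))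
    · have hba : P b a := ⟨q, hb, ha, h⟩
      by_cases hbU : b ∈ U
      · exact Or.inr (Or.inr (hD₁mem b a hbU hba))
      · exact Or.inl (Or.inr (hNN' b hbU a hba))
  have h3 := blockGraph_card_components_le S G
  have h4 := sum_card_components_le_blockGraph S hS G
  -- Points outside all blocks, isolated in the block graph, are unsettled too; they account for the
  -- `1` in `k + 1`.
  have h5 : {v | ∀ q, v ∉ S q}.ncard ≤ U.card := by
    rw [hUcard]
    refine Set.ncard_le_ncard (fun i hi => ?_) (Set.toFinite _)
    rintro ⟨q, hq, _⟩
    exact hi q (hBS i q hq)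
  rw [← hUcard]
  change Nat.card (nnGraph k p).ConnectedComponent ≤
      ∑ q, Nat.card (G q).ConnectedComponent + _ ∧
    ∑ q, Nat.card (G q).ConnectedComponent ≤ _
  have h6 : (k + 1) * U.card = U.card * k + U.card := by ring
  constructor <;> omega

/-- The cube with corner `a` and side length `s`. -/
def box (a : Fin d → ℝ) (s : ℝ) : Set (EuclideanSpace ℝ (Fin d)) :=
  {x | ∀ c, x c ∈ Set.Ico (a c) (a c + s)}

lemma abs_sub_le_dist (x y : EuclideanSpace ℝ (Fin d)) (c : Fin d) : |x c - y c| ≤ dist x y := by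
  rw [← Real.dist_eq]
  exact (PiLp.dist_apply_le x y c)

lemma ball_subset_box {a : Fin d → ℝ} {s ρ : ℝ} {x : EuclideanSpace ℝ (Fin d)}
    (hx : x ∈ box (fun c => a c + ρ) (s - 2 * ρ)) : Metric.ball x ρ ⊆ box a s := by
  intro y hy c
  rw [Metric.mem_ball] at hy
  have h1 := abs_le.1 ((abs_sub_le_dist y x c).trans hy.le)
  have h2 := abs_lt.1 ((abs_sub_le_dist y x c).trans_lt hy)
  have h3 := hx c
  constructor <;> linarith [h3.1, h3.2]

/-- The number of points with fewer than `k` other points within distance `ρ` inside a cube is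
bounded by a constant. -/
lemma ncard_sparse_mul_le (hd : 1 ≤ d) {ι : Type*} [Fintype ι] (k : ℕ)
    (p : ι → EuclideanSpace ℝ (Fin d)) (a : Fin d → ℝ) {s ρ : ℝ} (hρ : 0 < ρ) (hρs : ρ ≤ s) :
    ({i | p i ∈ box a s ∧ {l | p l ∈ box a s ∧ l ≠ i ∧ dist (p i) (p l) < ρ}.ncard < k}.ncard : ℝ)
      * ρ ^ d ≤ k * (4 * (s * √d)) ^ d := by
  classical
  set T := {i | p i ∈ box a s ∧ {l | p l ∈ box a s ∧ l ≠ i ∧ dist (p i) (p l) < ρ}.ncard < k}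
    with hT
  -- Packing with constant radius `ρ`: points of the box are within `s * √d` of its corner, and `ρ /
  -- 2` is at most `s * √d`, so all half-radius balls fit into a ball of radius `2 * (s * √d)`.
  have h := sum_pow_radius_le (k := k) hd (fun i : T => p i) (fun _ => ρ) (fun _ => hρ.le) ?_
    (WithLp.toLp 2 a) (ρ := 2 * (s * √d))
    (mul_nonneg two_pos.le (mul_nonneg (hρ.le.trans hρs) (Real.sqrt_nonneg _))) ?_
  · rw [Finset.sum_const, Finset.card_univ, nsmul_eq_mul, ← Nat.card_eq_fintype_card,
      Nat.card_coe_set_eq] at h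
    refine h.trans_eq ?_
    ring_nf
  · intro i
    refine lt_of_le_of_lt ?_ i.2.2
    rw [← Set.ncard_image_of_injective _ Subtype.val_injective]
    refine Set.ncard_le_ncard ?_ (Set.toFinite _)
    rintro _ ⟨l, hl, rfl⟩
    exact ⟨l.2.1, fun h => hl.1 (Subtype.ext h), hl.2⟩
  · intro i y hy
    rw [Metric.mem_ball] at hy ⊢
    have h1 : dist (p i) (WithLp.toLp 2 a) ≤ s * √d := by
      refine dist_le_of_coord_le (hρ.le.trans hρs) fun c => ?_
      have := i.2.1 c
      rw [abs_le]
      constructor <;> simp only <;> linarith [this.1, this.2]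
    have h2 : 1 ≤ √(d : ℝ) := Real.one_le_sqrt.2 (by exact_mod_cast hd)
    have h3 : s ≤ s * √d := le_mul_of_one_le_right (hρ.le.trans hρs) h2
    linarith [dist_triangle y (p i) (WithLp.toLp 2 a)]

/-- An unsettled point is outside all inner boxes or has fewer than `k` other points of its box
within `ρ`. The bound on the second kind depends only on `s / ρ`, not on the number of points. -/
lemma ncard_unsettled_le (hd : 1 ≤ d) {ι Q : Type*} [Fintype ι] [Fintype Q] (k : ℕ)
    (p : ι → EuclideanSpace ℝ (Fin d)) (a : Q → Fin d → ℝ) {s ρ : ℝ} (hρ : 0 < ρ) (hρs : ρ ≤ s) :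
    ((unsettled k p (fun q => box (a q) s)
        (fun q => box (fun c => a q c + ρ) (s - 2 * ρ)) ρ).ncard : ℝ) ≤
      {i | p i ∉ ⋃ q, box (fun c => a q c + ρ) (s - 2 * ρ)}.ncard +
        Fintype.card Q * (k * (4 * √d) ^ d * (s / ρ) ^ d) := by
  classical
  set T : Q → Set ι := fun q => {i | p i ∈ box (a q) s ∧
    {l | p l ∈ box (a q) s ∧ l ≠ i ∧ dist (p i) (p l) < ρ}.ncard < k} with hT
  have hTle : ∀ q, ((T q).ncard : ℝ) ≤ k * (4 * √d) ^ d * (s / ρ) ^ d := by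
    intro q
    have := ncard_sparse_mul_le hd k p (a q) hρ hρs
    rw [← le_div_iff₀ (by positivity)] at this
    refine this.trans_eq ?_
    rw [div_pow, mul_pow, mul_pow, mul_pow]
    ring
  have hsub : unsettled k p (fun q => box (a q) s)
      (fun q => box (fun c => a q c + ρ) (s - 2 * ρ)) ρ ⊆
      {i | p i ∉ ⋃ q, box (fun c => a q c + ρ) (s - 2 * ρ)} ∪
        ((Finset.univ.biUnion fun q => (T q).toFinset : Finset ι) : Set ι) := by
    intro i hi
    by_cases h : p i ∈ ⋃ q, box (fun c => a q c + ρ) (s - 2 * ρ)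
    · right
      obtain ⟨q, hq⟩ := Set.mem_iUnion.1 h
      simp only [Finset.coe_biUnion, Set.coe_toFinset, Set.mem_iUnion]
      refine ⟨q, Finset.mem_coe.2 (Finset.mem_univ _),
        ball_subset_box hq (Metric.mem_ball_self hρ), ?_⟩
      by_contra hcon
      push Not at hcon
      exact hi ⟨q, hq, hcon⟩
    · exact Or.inl h
  have h1 := (Set.ncard_le_ncard hsub (Set.toFinite _)).trans (Set.ncard_union_le _ _)
  rw [Set.ncard_coe_finset] at h1
  have h2 : ((Finset.univ.biUnion fun q => (T q).toFinset).card : ℝ) ≤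
      Fintype.card Q * (k * (4 * √d) ^ d * (s / ρ) ^ d) := by
    have : (Finset.univ.biUnion fun q => (T q).toFinset).card ≤
        ∑ q, (T q).toFinset.card := Finset.card_biUnion_le
    calc ((Finset.univ.biUnion fun q => (T q).toFinset).card : ℝ)
        ≤ ∑ q, ((T q).ncard : ℝ) := by
          simp only [Set.ncard_eq_toFinset_card']
          exact_mod_cast this
      _ ≤ ∑ _q : Q, k * (4 * √d) ^ d * (s / ρ) ^ d := Finset.sum_le_sum fun q _ => hTle q
      _ = _ := by simp
  calc _ ≤ (({i | p i ∉ ⋃ q, box (fun c => a q c + ρ) (s - 2 * ρ)}.ncard +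
        (Finset.univ.biUnion fun q => (T q).toFinset).card : ℕ) : ℝ) := by exact_mod_cast h1
    _ ≤ _ := by push_cast; gcongr

end Comparison

/-! ### Clusters of points that are cut off from all other points -/

section IsolatedClusters

variable {d : ℕ}

/-- The half-open cubes of a grid. -/
def gridCube (δ : ℝ) (v : Fin d → ℤ) : Set (EuclideanSpace ℝ (Fin d)) :=
  box (fun c => δ * v c) δ

/-- The number of points in a set. -/
def count {ι X : Type*} (p : ι → X) (A : Set X) : ℕ := {i | p i ∈ A}.ncard

lemma mem_gridCube_floor {δ : ℝ} (hδ : 0 < δ) (x : EuclideanSpace ℝ (Fin d)) :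
    x ∈ gridCube δ fun c => ⌊x c / δ⌋ := by
  intro c
  constructor
  · have := Int.floor_le (x c / δ)
    rw [le_div_iff₀ hδ] at this
    linarith
  · have := Int.lt_floor_add_one (x c / δ)
    rw [div_lt_iff₀ hδ] at this
    linarith

lemma gridCube_disjoint {δ : ℝ} (hδ : 0 < δ) {u v : Fin d → ℤ} (huv : u ≠ v) :
    Disjoint (gridCube δ u) (gridCube δ v) := by
  rw [Set.disjoint_left]
  intro x hu hv
  refine huv (funext fun c => ?_)
  have h1 := hu c
  have h2 := hv c
  have h3 : (u c : ℝ) < v c + 1 := by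
    have := h1.1.trans_lt h2.2
    rw [← mul_add_one] at this
    exact lt_of_mul_lt_mul_left this hδ.le
  have h4 : (v c : ℝ) < u c + 1 := by
    have := h2.1.trans_lt h1.2
    rw [← mul_add_one] at this
    exact lt_of_mul_lt_mul_left this hδ.le
  have h5 : u c < v c + 1 := by exact_mod_cast h3
  have h6 : v c < u c + 1 := by exact_mod_cast h4
  omega

/-- The points in the grid cube `C` are separated from all other points: an empty region around it
is surrounded by a layer of well-filled grid cubes. -/
def IsSeparated {ι : Type*} (k : ℕ) (δ : ℝ) (p : ι → EuclideanSpace ℝ (Fin d))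
    (C : Fin d → ℤ) : Prop :=
  ∀ u : Fin d → ℤ, (∀ c, |u c - C c| ≤ d + 2) →
    if u = C ∨ ∃ c, |u c - C c| = d + 2 then k + 1 ≤ count p (gridCube δ u)
    else count p (gridCube δ u) = 0

/-- A loss of at most `δ ^ 2` in each coordinate is outweighed by one coordinate with a gain of `(d
+ 1) ^ 2 * δ ^ 2`. This is why the shell in `IsSeparated` sits at grid distance `d + 2`: points of
grid cubes that far apart differ by more than `(d + 1) * δ`. -/
lemma dist_lt_dist_of_coord {x y z : EuclideanSpace ℝ (Fin d)} {δ : ℝ} (hδ : 0 < δ)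
    (h : ∀ c, (x c - y c) ^ 2 ≤ (x c - z c) ^ 2 + δ ^ 2)
    (h' : ∃ c, (x c - y c) ^ 2 + (d + 1) ^ 2 * δ ^ 2 ≤ (x c - z c) ^ 2 + δ ^ 2) :
    dist x y < dist x z := by
  classical
  obtain ⟨c, hc⟩ := h'
  rw [EuclideanSpace.dist_eq, EuclideanSpace.dist_eq]
  refine Real.sqrt_lt_sqrt (Finset.sum_nonneg fun _ _ => sq_nonneg _) ?_
  simp only [Real.dist_eq, sq_abs]
  rw [← Finset.add_sum_erase _ _ (Finset.mem_univ c),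
    ← Finset.add_sum_erase (Finset.univ) (fun c => (x c - z c) ^ 2) (Finset.mem_univ c)]
  have h1 : ∑ e ∈ Finset.univ.erase c, (x e - y e) ^ 2 ≤
      ∑ e ∈ Finset.univ.erase c, ((x e - z e) ^ 2 + δ ^ 2) := Finset.sum_le_sum fun e _ => h e
  rw [Finset.sum_add_distrib, Finset.sum_const, nsmul_eq_mul] at h1
  have h2 : ((Finset.univ.erase c).card : ℝ) ≤ d := by
    have := Finset.card_le_univ (Finset.univ.erase c)
    rw [Fintype.card_fin] at this
    exact_mod_cast this
  have h3 : 0 < δ ^ 2 := by positivity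
  have h4 : (0 : ℝ) < d := by exact_mod_cast c.pos
  nlinarith [mul_le_mul_of_nonneg_right h2 h3.le, mul_nonneg (sq_nonneg (d : ℝ)) h3.le,
    mul_pos h4 h3]

/-- Otherwise the point would lie in a grid cube that is required to be empty. -/
lemma exists_large_index {ι : Type*} {k : ℕ} {δ : ℝ} (hδ : 0 < δ) [Finite ι]
    {p : ι → EuclideanSpace ℝ (Fin d)} {C : Fin d → ℤ} (h : IsSeparated k δ p C) {j : ι}
    (hj : p j ∉ gridCube δ C) : ∃ c, (d + 2 : ℤ) ≤ |⌊p j c / δ⌋ - C c| := by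
  by_contra! hlt
  have h1 := h (fun c => ⌊p j c / δ⌋) fun c => (hlt c).le
  have hmem := mem_gridCube_floor hδ (p j)
  rw [if_neg] at h1
  · rw [count, Set.ncard_eq_zero] at h1
    exact Set.notMem_empty j (h1 ▸ hmem)
  · rintro (h2 | ⟨c, hc⟩)
    · exact hj (h2 ▸ hmem)
    · exact (hlt c).ne hc

/-- With `k + 1` points in `A`, at least `k` of them differ from `i`, even if `i` itself lies in
`A`. -/
lemma not_isNN_of_closer {ι X : Type*} [PseudoMetricSpace X] [Finite ι] {k : ℕ} {p : ι → X}
    {i j : ι} {A : Set X} (hA : k + 1 ≤ count p A)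
    (hlt : ∀ l, p l ∈ A → dist (p i) (p l) < dist (p i) (p j)) : ¬ IsNN k p i j := by
  intro h
  have h1 : {l | p l ∈ A} \ {i} ⊆ {l : ι | l ≠ i ∧ dist (p i) (p l) < dist (p i) (p j)} :=
    fun l hl => ⟨hl.2, hlt l hl.1⟩
  have h2 := Set.ncard_le_ncard h1 (Set.toFinite _)
  have h3 := Set.pred_ncard_le_ncard_sdiff_singleton {l | p l ∈ A} i
  have h4 := h.2
  rw [count] at hA
  omega

lemma gridCube_coord {δ : ℝ} {v : Fin d → ℤ} {x : EuclideanSpace ℝ (Fin d)}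
    (hx : x ∈ gridCube δ v) (c : Fin d) : δ * v c ≤ x c ∧ x c < δ * v c + δ := hx c

/-- A point outside cannot be a neighbour of a point of `C`, because the other points of `C` are
closer. A point of `C` cannot be a neighbour of a point outside, because the latter has a shell cube
full of closer points. -/
lemma IsSeparated.mem_of_adj {ι : Type*} [Finite ι] {k : ℕ} {δ : ℝ} (hδ : 0 < δ)
    {p : ι → EuclideanSpace ℝ (Fin d)} {C : Fin d → ℤ} (h : IsSeparated k δ p C) {i j : ι}
    (hi : p i ∈ gridCube δ C) (hij : (nnGraph k p).Adj i j) : p j ∈ gridCube δ C := by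
  by_contra hj
  set v : Fin d → ℤ := fun c => ⌊p j c / δ⌋
  obtain ⟨c₀, hc₀⟩ : ∃ c, (d + 2 : ℤ) ≤ |v c - C c| := exists_large_index hδ h hj
  have hjv : p j ∈ gridCube δ v := mem_gridCube_floor hδ (p j)
  have hd0 : (0 : ℝ) ≤ d := Nat.cast_nonneg d
  -- far coordinates: `C` and `v` differ by at least `d + 2` there
  have hfar : ∀ c, (d + 2 : ℤ) ≤ |v c - C c| → ((d : ℝ) + 2 ≤ v c - C c) ∨
      ((d : ℝ) + 2 ≤ C c - v c) := by
    intro c hc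
    rcases le_abs'.1 hc with h1 | h1
    · right
      have : (d + 2 : ℤ) ≤ C c - v c := by linarith
      exact_mod_cast this
    · left
      exact_mod_cast h1
  rcases hij with hNN | hNN
  · refine not_isNN_of_closer (A := gridCube δ C) ?_ ?_ hNN
    · have := h C fun c => by simp; positivity
      rwa [if_pos (Or.inl rfl)] at this
    · intro l hl
      have hclose : ∀ c, (p i c - p l c) ^ 2 ≤ δ ^ 2 := by
        intro c
        have h1 := gridCube_coord hi c
        have h2 := gridCube_coord hl c
        rw [sq_le_sq, abs_of_pos hδ, abs_le]
        constructor <;> linarith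
      refine dist_lt_dist_of_coord hδ (fun c => ?_) ⟨c₀, ?_⟩
      · linarith [hclose c, sq_nonneg (p i c - p j c)]
      · have h1 := gridCube_coord hi c₀
        have h2 := gridCube_coord hjv c₀
        have h3 : ((d + 1) * δ) ^ 2 ≤ (p i c₀ - p j c₀) ^ 2 := by
          rw [sq_le_sq, abs_of_nonneg (by positivity)]
          rcases hfar c₀ hc₀ with h4 | h4
          · exact le_abs.2 (Or.inr (by nlinarith))
          · exact le_abs.2 (Or.inl (by nlinarith))
        have := hclose c₀
        rw [mul_pow] at h3
        linarith
  · -- the grid cube in the layer around `C` that is closest to `p j`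
    set u : Fin d → ℤ := fun c => max (C c - (d + 2)) (min (v c) (C c + (d + 2))) with hu
    refine not_isNN_of_closer (A := gridCube δ u) ?_ ?_ hNN
    · have := h u fun c => by rw [abs_le]; simp only [hu]; constructor <;> omega
      rwa [if_pos] at this
      refine Or.inr ⟨c₀, ?_⟩
      rcases le_abs'.1 hc₀ with h1 | h1
      · have : u c₀ - C c₀ = -(d + 2) := by simp only [hu]; omega
        rw [this, abs_neg]; exact abs_of_nonneg (by positivity)
      · have : u c₀ - C c₀ = d + 2 := by simp only [hu]; omega
        rw [this]; exact abs_of_nonneg (by positivity)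
    · intro l hl
      -- Either the clamping left this coordinate alone, and both points share a slab of width `δ`,
      -- or the shell point lies between `p j` and the cube `C` and is nearer than `p i` by at least
      -- `(d + 1) * δ`.
      have hcoord : ∀ c, (p j c - p l c) ^ 2 ≤ δ ^ 2 ∧ v c = u c ∨
          (p j c - p l c) ^ 2 + ((d + 1) * δ) ^ 2 ≤ (p j c - p i c) ^ 2 := by
        intro c
        have h1 := gridCube_coord hi c
        have h2 := gridCube_coord hl c
        have h3 := gridCube_coord hjv c
        have hw : 0 ≤ (d + 1) * δ := by positivity
        rcases lt_trichotomy (v c) (u c) with hlt | heq | hgt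
        · right
          have huc : u c = C c - (d + 2) := by simp only [hu] at hlt ⊢; omega
          have huc' : (u c : ℝ) = C c - (d + 2) := by rw [huc]; push_cast; ring
          have hvu : (v c : ℝ) + 1 ≤ u c := by exact_mod_cast hlt
          have ha : 0 ≤ p l c - p j c := by nlinarith
          have hb : p l c - p j c + (d + 1) * δ ≤ p i c - p j c := by
            rw [huc'] at h2; nlinarith
          nlinarith [pow_le_pow_left₀ (by positivity) hb 2, mul_nonneg ha hw]
        · left
          refine ⟨?_, heq⟩
          rw [← heq] at h2
          rw [sq_le_sq, abs_of_pos hδ, abs_le]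
          constructor <;> linarith
        · right
          have huc : u c = C c + (d + 2) := by simp only [hu] at hgt ⊢; omega
          have huc' : (u c : ℝ) = C c + (d + 2) := by rw [huc]; push_cast; ring
          have hvu : (u c : ℝ) + 1 ≤ v c := by exact_mod_cast hgt
          have ha : 0 ≤ p j c - p l c := by nlinarith
          have hb : p j c - p l c + (d + 1) * δ ≤ p j c - p i c := by
            rw [huc'] at h2; nlinarith
          nlinarith [pow_le_pow_left₀ (by positivity) hb 2, mul_nonneg ha hw]
      refine dist_lt_dist_of_coord hδ (fun c => ?_) ⟨c₀, ?_⟩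
      · rcases hcoord c with h1 | h1
        · linarith [h1.1, sq_nonneg (p j c - p i c)]
        · nlinarith [sq_nonneg ((d + 1) * δ)]
      · rcases hcoord c₀ with ⟨h1, h2⟩ | h1
        · have h3 := gridCube_coord hi c₀
          have h4 := gridCube_coord hjv c₀
          have h5 : ((d + 1) * δ) ^ 2 ≤ (p j c₀ - p i c₀) ^ 2 := by
            rw [sq_le_sq, abs_of_nonneg (by positivity)]
            rcases hfar c₀ hc₀ with h6 | h6
            · exact le_abs.2 (Or.inl (by nlinarith))
            · exact le_abs.2 (Or.inr (by nlinarith))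
          rw [mul_pow] at h5
          linarith
        · rw [mul_pow] at h1
          nlinarith [sq_nonneg δ]

/-- There are at least as many components as separated grid cubes. -/
lemma card_isSeparated_le {ι : Type*} [Finite ι] {k : ℕ} {δ : ℝ} (hδ : 0 < δ)
    (p : ι → EuclideanSpace ℝ (Fin d)) {Q : Type*} (C : Q → Fin d → ℤ)
    (hC : Function.Injective C) (T : Finset Q) (hT : ∀ q ∈ T, IsSeparated k δ p (C q)) :
    T.card ≤ Nat.card (nnGraph k p).ConnectedComponent := by
  refine card_le_card_components _ T (fun q => {i | p i ∈ gridCube δ (C q)}) ?_ ?_ ?_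
  · intro q _ r _ hqr
    exact Set.disjoint_left.2 fun i h1 h2 =>
      Set.disjoint_left.1 (gridCube_disjoint hδ (hC.ne hqr)) h1 h2
  · intro q hq
    have := hT q hq (C q) fun c => by simp; positivity
    rw [if_pos (Or.inl rfl), count] at this
    exact Set.nonempty_of_ncard_ne_zero (by omega)
  · intro q hq a ha b hab
    exact (hT q hq).mem_of_adj hδ ha hab

end IsolatedClusters

/-! ### Poisson expectations: restriction, independence, images and counts -/

section Poisson

open scoped Nat


/-- The expectation of a function of the points of a Poisson process with intensity measure `μ`. -/
def poissonLintegral {X : Type*} [MeasurableSpace X] (μ : Measure X) (h : ∀ m : ℕ, (Fin m → X) → ℝ≥0∞) : ℝ≥0∞ :=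
  ENNReal.ofReal (Real.exp (-(μ Set.univ).toReal)) *
    ∑' m : ℕ, (m ! : ℝ≥0∞)⁻¹ * ∫⁻ p, h m p ∂Measure.pi fun _ : Fin m => μ

/-- The points with indices in `S`, enumerated. -/
def subSample {X : Type*} {m : ℕ} (p : Fin m → X) (S : Finset (Fin m)) : Fin S.card → X :=
  fun a => p (S.equivFin.symm a)

open scoped Classical in
/-- The indices of the points in `A`. -/
def indicesIn {X : Type*} {m : ℕ} (A : Set X) (p : Fin m → X) : Finset (Fin m) :=
  Finset.univ.filter fun i => p i ∈ A

lemma mem_indicesIn {X : Type*} {m : ℕ} {A : Set X} {p : Fin m → X} {i : Fin m} :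
    i ∈ indicesIn A p ↔ p i ∈ A := by
  simp [indicesIn]

lemma card_indicesIn {X : Type*} {m : ℕ} (A : Set X) (p : Fin m → X) :
    (indicesIn A p).card = count p A := by
  classical
  rw [indicesIn, count, ← Set.ncard_coe_finset, Finset.coe_filter_univ]

variable {X Y : Type*} [MeasurableSpace X] [MeasurableSpace Y]

lemma lintegral_pi_equiv (μ : Measure X) [SigmaFinite μ] {ι κ : Type*} [Fintype ι] [Fintype κ]
    (e : κ ≃ ι) (h : (κ → X) → ℝ≥0∞) (hh : Measurable h) :
    ∫⁻ q : ι → X, h (fun a => q (e a)) ∂Measure.pi (fun _ => μ) =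
      ∫⁻ q, h q ∂Measure.pi fun _ => μ := by
  have hmp := measurePreserving_piCongrLeft (fun _ : ι => μ) e
  have hm : Measurable fun q : ι → X => h (fun a => q (e a)) := by
    fun_prop
  rw [← hmp.lintegral_comp hm]
  refine lintegral_congr fun q => ?_
  congr 1
  ext a
  exact Equiv.piCongrLeft_apply_apply (fun _ => X) e q a

lemma setLIntegral_pi_equiv (μ : Measure X) [SigmaFinite μ] {ι : Type*} [Fintype ι] {j : ℕ}
    (e : Fin j ≃ ι) (A : Set X) (hA : MeasurableSet A) (h : (Fin j → X) → ℝ≥0∞)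
    (hh : Measurable h) :
    ∫⁻ q : ι → X, (Set.univ.pi fun _ => A).indicator (fun q => h fun a => q (e a)) q
        ∂Measure.pi (fun _ => μ) =
      ∫⁻ q, h q ∂Measure.pi fun _ => μ.restrict A := by
  rw [lintegral_indicator (MeasurableSet.univ_pi fun _ => hA), Measure.restrict_pi_pi,
    lintegral_pi_equiv (μ.restrict A) e h hh]

open scoped Classical in
-- Sort the tuples by the set `S` of indices of points in `A`. On each piece the product measure
-- factors into the coordinates in `S` and those outside.
lemma lintegral_split (μ : Measure X) [IsFiniteMeasure μ] {A : Set X} (hA : MeasurableSet A)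
    (h₁ h₂ : ∀ m : ℕ, (Fin m → X) → ℝ≥0∞) (hh₁ : ∀ m, Measurable (h₁ m))
    (hh₂ : ∀ m, Measurable (h₂ m)) (m : ℕ) :
    ∫⁻ p : Fin m → X, h₁ _ (subSample p (indicesIn A p)) * h₂ _ (subSample p (indicesIn A p)ᶜ)
        ∂Measure.pi (fun _ => μ) =
      ∑ S : Finset (Fin m), (∫⁻ q, h₁ S.card q ∂Measure.pi fun _ => μ.restrict A) *
        ∫⁻ q, h₂ Sᶜ.card q ∂Measure.pi fun _ => μ.restrict Aᶜ := by
  set e₁ : ∀ S : Finset (Fin m), Fin S.card ≃ {i // i ∈ S} := fun S => S.equivFin.symm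
  set e₂ : ∀ S : Finset (Fin m), Fin Sᶜ.card ≃ {i // i ∉ S} := fun S =>
    Sᶜ.equivFin.symm.trans (Equiv.subtypeEquivRight fun i => Finset.mem_compl)
  set g₁ : ∀ S : Finset (Fin m), ({i // i ∈ S} → X) → ℝ≥0∞ := fun S =>
    (Set.univ.pi fun _ => A).indicator (fun q => h₁ S.card fun a => q (e₁ S a)) with hg₁
  set g₂ : ∀ S : Finset (Fin m), ({i // i ∉ S} → X) → ℝ≥0∞ := fun S =>
    (Set.univ.pi fun _ => Aᶜ).indicator (fun q => h₂ Sᶜ.card fun a => q (e₂ S a)) with hg₂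
  have hg₁m : ∀ S, Measurable (g₁ S) := fun S =>
    Measurable.indicator (by have := hh₁ S.card; fun_prop) (MeasurableSet.univ_pi fun _ => hA)
  have hg₂m : ∀ S, Measurable (g₂ S) := fun S =>
    Measurable.indicator (by have := hh₂ Sᶜ.card; fun_prop)
      (MeasurableSet.univ_pi fun _ => hA.compl)
  have hpt : ∀ p : Fin m → X,
      h₁ _ (subSample p (indicesIn A p)) * h₂ _ (subSample p (indicesIn A p)ᶜ) =
        ∑ S : Finset (Fin m), g₁ S (fun i => p i) * g₂ S fun i => p i := by
    intro p
    rw [Finset.sum_eq_single (indicesIn A p)]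
    · rw [hg₁, hg₂]
      simp only
      rw [Set.indicator_of_mem, Set.indicator_of_mem]
      · rfl
      · exact fun i _ => fun hi => i.2 (mem_indicesIn.2 hi)
      · exact fun i _ => mem_indicesIn.1 i.2
    · intro S _ hS
      by_contra hne
      refine hS (Finset.ext fun i => ?_)
      have h1 := Set.mem_of_indicator_ne_zero (left_ne_zero_of_mul hne)
      have h2 := Set.mem_of_indicator_ne_zero (right_ne_zero_of_mul hne)
      rw [mem_indicesIn]
      refine ⟨fun hi => h1 ⟨i, hi⟩ trivial, fun hi => ?_⟩
      by_contra hiS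
      exact h2 ⟨i, hiS⟩ trivial hi
    · simp
  simp_rw [hpt]
  rw [lintegral_finsetSum]
  · refine Finset.sum_congr rfl fun S _ => ?_
    have hmp := measurePreserving_piEquivPiSubtypeProd (fun _ : Fin m => μ) (fun i => i ∈ S)
    have h3 := hmp.lintegral_comp (f := fun z => g₁ S z.1 * g₂ S z.2)
      (((hg₁m S).comp measurable_fst).mul ((hg₂m S).comp measurable_snd))
    rw [lintegral_prod_mul (hg₁m S).aemeasurable (hg₂m S).aemeasurable] at h3
    refine h3.trans ?_
    congr 1
    · convert setLIntegral_pi_equiv μ (e₁ S) A hA _ (hh₁ _)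
    · exact setLIntegral_pi_equiv μ (e₂ S) Aᶜ hA.compl _ (hh₂ _)
  · intro S _
    have := hg₁m S
    have := hg₂m S
    fun_prop

lemma tsum_mul_tsum_antidiagonal (f g : ℕ → ℝ≥0∞) :
    ∑' m, ∑ kl ∈ Finset.HasAntidiagonal.antidiagonal m, f kl.1 * g kl.2 = (∑' m, f m) * ∑' m, g m := by
  calc ∑' m, ∑ kl ∈ Finset.HasAntidiagonal.antidiagonal m, f kl.1 * g kl.2
      = ∑' x : Σ m : ℕ, Finset.HasAntidiagonal.antidiagonal m, f (x.2 : ℕ × ℕ).1 * g (x.2 : ℕ × ℕ).2 := by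
        rw [ENNReal.tsum_sigma']
        refine tsum_congr fun m => ?_
        rw [tsum_fintype, ← Finset.sum_coe_sort]
    _ = ∑' x : ℕ × ℕ, f x.1 * g x.2 :=
        Finset.HasAntidiagonal.sigmaAntidiagonalEquivProd.tsum_eq fun x : ℕ × ℕ => f x.1 * g x.2
    _ = (∑' m, f m) * ∑' m, g m := by
        rw [ENNReal.tsum_prod (f := fun a b => f a * g b)]
        simp_rw [ENNReal.tsum_mul_left, ENNReal.tsum_mul_right]

/-- The points of a Poisson process inside and outside of a set are independent Poisson
processes. -/
lemma poissonLintegral_split (μ : Measure X) [IsFiniteMeasure μ] {A : Set X}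
    (hA : MeasurableSet A) (h₁ h₂ : ∀ m : ℕ, (Fin m → X) → ℝ≥0∞)
    (hh₁ : ∀ m, Measurable (h₁ m)) (hh₂ : ∀ m, Measurable (h₂ m)) :
    poissonLintegral μ (fun _ p => h₁ _ (subSample p (indicesIn A p)) *
        h₂ _ (subSample p (indicesIn A p)ᶜ)) =
      poissonLintegral (μ.restrict A) h₁ * poissonLintegral (μ.restrict Aᶜ) h₂ := by
  unfold poissonLintegral
  simp_rw [lintegral_split μ hA h₁ h₂ hh₁ hh₂]
  set f : ℕ → ℝ≥0∞ := fun j => ∫⁻ q, h₁ j q ∂Measure.pi fun _ => μ.restrict A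
  set g : ℕ → ℝ≥0∞ := fun j => ∫⁻ q, h₂ j q ∂Measure.pi fun _ => μ.restrict Aᶜ
  have hterm : ∀ m : ℕ, (m ! : ℝ≥0∞)⁻¹ * ∑ S : Finset (Fin m), f S.card * g Sᶜ.card =
      ∑ kl ∈ Finset.HasAntidiagonal.antidiagonal m,
        ((kl.1 ! : ℝ≥0∞)⁻¹ * f kl.1) * ((kl.2 ! : ℝ≥0∞)⁻¹ * g kl.2) := by
    intro m
    -- The summand depends only on the size of `S`; the binomial coefficient then turns `1 / m !`
    -- into `1 / (j ! * (m - j)!)`, and the series becomes a Cauchy product.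
    have h1 : ∑ S : Finset (Fin m), f S.card * g Sᶜ.card =
        ∑ j ∈ Finset.range (m + 1), m.choose j • (f j * g (m - j)) := by
      have := Finset.sum_powerset_apply_card (fun j => f j * g (m - j))
        (x := (Finset.univ : Finset (Fin m)))
      rw [Finset.card_univ, Fintype.card_fin, Finset.powerset_univ] at this
      rw [← this]
      refine Finset.sum_congr rfl fun S _ => ?_
      rw [Finset.card_compl, Fintype.card_fin]
    rw [h1, Finset.Nat.sum_antidiagonal_eq_sum_range_succ
      (fun a b => ((a ! : ℝ≥0∞)⁻¹ * f a) * ((b ! : ℝ≥0∞)⁻¹ * g b)), Finset.mul_sum]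
    refine Finset.sum_congr rfl fun j hj => ?_
    have hjm : j ≤ m := Nat.lt_succ_iff.1 (Finset.mem_range.1 hj)
    have hfac : ∀ a : ℕ, (a ! : ℝ≥0∞) ≠ 0 := fun a => by exact_mod_cast a.factorial_ne_zero
    have hfin : ∀ a : ℕ, (a ! : ℝ≥0∞) ≠ ⊤ := fun a => ENNReal.natCast_ne_top _
    have h2 : (m ! : ℝ≥0∞)⁻¹ * m.choose j = (j ! : ℝ≥0∞)⁻¹ * ((m - j)! : ℝ≥0∞)⁻¹ := by
      rw [← Nat.choose_mul_factorial_mul_factorial hjm]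
      push_cast
      have hc : (m.choose j : ℝ≥0∞) ≠ 0 := by exact_mod_cast (Nat.choose_pos hjm).ne'
      have hc' : (m.choose j : ℝ≥0∞) ≠ ⊤ := ENNReal.natCast_ne_top _
      rw [mul_assoc, ENNReal.mul_inv (Or.inl hc) (Or.inl hc'),
        ENNReal.mul_inv (Or.inl (hfac _)) (Or.inl (hfin _)), mul_comm, ← mul_assoc,
        ENNReal.mul_inv_cancel hc hc', one_mul]
    rw [nsmul_eq_mul, ← mul_assoc, h2]
    ring
  rw [tsum_congr hterm, tsum_mul_tsum_antidiagonal (fun j => (j ! : ℝ≥0∞)⁻¹ * f j) fun j => (j ! : ℝ≥0∞)⁻¹ * g j]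
  have hexp : ENNReal.ofReal (Real.exp (-(μ Set.univ).toReal)) =
      ENNReal.ofReal (Real.exp (-((μ.restrict A) Set.univ).toReal)) *
        ENNReal.ofReal (Real.exp (-((μ.restrict Aᶜ) Set.univ).toReal)) := by
    rw [← ENNReal.ofReal_mul (Real.exp_pos _).le, ← Real.exp_add, Measure.restrict_apply_univ,
      Measure.restrict_apply_univ, ← measure_add_measure_compl hA,
      ENNReal.toReal_add (measure_ne_top _ _) (measure_ne_top _ _)]
    congr 2
    ring
  rw [hexp]
  ring

lemma lintegral_poissonMeasure (r : ℝ≥0) (g : ℕ → ℝ≥0∞) :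
    ∫⁻ j, g j ∂poissonMeasure r =
      ∑' j : ℕ, ENNReal.ofReal (Real.exp (-r) * r ^ j / j !) * g j := by
  rw [poissonMeasure, lintegral_sum_measure]
  simp

/-- The number of points of a Poisson process is Poisson distributed. -/
lemma poissonLintegral_card (μ : Measure X) [IsFiniteMeasure μ] (g : ℕ → ℝ≥0∞) :
    poissonLintegral μ (fun m _ => g m) = ∫⁻ j, g j ∂poissonMeasure (μ Set.univ).toNNReal := by
  rw [lintegral_poissonMeasure, poissonLintegral, ← ENNReal.tsum_mul_left]
  refine tsum_congr fun j => ?_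
  have h1 : μ Set.univ = ENNReal.ofReal ((μ Set.univ).toNNReal : ℝ) := by
    rw [ENNReal.ofReal_coe_nnreal, ENNReal.coe_toNNReal (measure_ne_top _ _)]
  rw [lintegral_const, Measure.pi_univ, Finset.prod_const, Finset.card_univ, Fintype.card_fin,
    mul_div_assoc, ENNReal.ofReal_mul (Real.exp_pos _).le,
    ENNReal.ofReal_div_of_pos (by positivity), ENNReal.ofReal_pow (by positivity), ← h1,
    ENNReal.ofReal_natCast, ENNReal.div_eq_inv_mul]
  have h2 : (μ Set.univ).toReal = ((μ Set.univ).toNNReal : ℝ) := rfl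
  rw [h2]
  ring

lemma poissonLintegral_one (μ : Measure X) [IsFiniteMeasure μ] :
    poissonLintegral μ (fun _ _ => 1) = 1 := by
  rw [poissonLintegral_card μ fun _ => 1]
  simp

/-- Splitting with the constant `1` outside of `A`, whose Poisson expectation is `1`. -/
lemma poissonLintegral_restrict (μ : Measure X) [IsFiniteMeasure μ] {A : Set X}
    (hA : MeasurableSet A) (h : ∀ m : ℕ, (Fin m → X) → ℝ≥0∞) (hh : ∀ m, Measurable (h m)) :
    poissonLintegral μ (fun _ p => h _ (subSample p (indicesIn A p))) =
      poissonLintegral (μ.restrict A) h := by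
  have := poissonLintegral_split μ hA h (fun _ _ => 1) hh fun _ => measurable_const
  simpa [poissonLintegral_one] using this

lemma poissonLintegral_map (μ : Measure X) [IsFiniteMeasure μ] {f : X → Y} (hf : Measurable f)
    (h : ∀ m : ℕ, (Fin m → Y) → ℝ≥0∞) (hh : ∀ m, Measurable (h m)) :
    poissonLintegral (μ.map f) h = poissonLintegral μ fun m p => h m fun i => f (p i) := by
  unfold poissonLintegral
  rw [Measure.map_apply hf MeasurableSet.univ, Set.preimage_univ]
  congr 1
  refine tsum_congr fun m => ?_
  rw [← Measure.pi_map_pi (fun _ => hf.aemeasurable), lintegral_map (hh m) (by fun_prop)]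

lemma measurable_count {m : ℕ} {A : Set X} (hA : MeasurableSet A) :
    Measurable fun p : Fin m → X => count p A := by
  classical
  have : (fun p : Fin m → X => count p A) = fun p => ∑ i, if p i ∈ A then 1 else 0 := by
    funext p
    rw [← card_indicesIn, indicesIn, Finset.card_filter]
  rw [this]
  refine Finset.measurable_fun_sum _ fun i _ => Measurable.ite ?_ measurable_const measurable_const
  exact (measurable_pi_apply i) hA

lemma count_subSample_compl {X : Type*} {m : ℕ} {A B : Set X} (hAB : Disjoint A B) (p : Fin m → X) :
    count (subSample p (indicesIn A p)ᶜ) B = count p B := by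
  set S := (indicesIn A p)ᶜ with hS
  have : (fun a => (S.equivFin.symm a : Fin m)) '' {a | subSample p S a ∈ B} =
      {i | p i ∈ B} := by
    ext i
    constructor
    · rintro ⟨a, ha, rfl⟩
      exact ha
    · intro hi
      have hiS : i ∈ S := by
        rw [hS, Finset.mem_compl, mem_indicesIn]
        exact fun h => Set.disjoint_left.1 hAB h hi
      exact ⟨S.equivFin ⟨i, hiS⟩, by simpa [subSample] using hi, by simp⟩
  rw [count, count, ← this, Set.ncard_image_of_injective]
  exact Subtype.val_injective.comp S.equivFin.symm.injective

/-- The numbers of points of a Poisson process in disjoint sets are independent. -/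
lemma poissonLintegral_prod_count {I : Type*} (s : Finset I) (A : I → Set X)
    (hA : ∀ i ∈ s, MeasurableSet (A i))
    (hd : ∀ i ∈ s, ∀ j ∈ s, i ≠ j → Disjoint (A i) (A j)) (g : I → ℕ → ℝ≥0∞) :
    ∀ (μ : Measure X) [IsFiniteMeasure μ],
      poissonLintegral μ (fun _ p => ∏ i ∈ s, g i (count p (A i))) =
        ∏ i ∈ s, ∫⁻ j, g i j ∂poissonMeasure (μ (A i)).toNNReal := by
  classical
  induction s using Finset.induction_on with
  | empty =>
    intro μ _
    simpa using poissonLintegral_one μ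
  | insert a s ha ih =>
    intro μ _
    have ih' := ih (fun i hi => hA i (Finset.mem_insert_of_mem hi))
      (fun i hi j hj => hd i (Finset.mem_insert_of_mem hi) j (Finset.mem_insert_of_mem hj))
    have hAa := hA a (Finset.mem_insert_self a s)
    have hdis : ∀ i ∈ s, Disjoint (A a) (A i) := fun i hi =>
      hd a (Finset.mem_insert_self a s) i (Finset.mem_insert_of_mem hi)
        (fun h => ha (h ▸ hi))
    rw [Finset.prod_insert ha]
    -- Split off the points in `A a`: the other sets lie in its complement, so their counts and
    -- measures do not change, and the induction hypothesis applies to the restricted measure.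
    have hsplit := poissonLintegral_split μ hAa (fun m _ => g a m)
      (fun _ q => ∏ i ∈ s, g i (count q (A i))) (fun _ => measurable_const)
      (fun m => Finset.measurable_fun_prod _ fun i hi => Measurable.comp
        (measurable_from_nat : Measurable (g i))
        (measurable_count (hA i (Finset.mem_insert_of_mem hi))))
    rw [ih', poissonLintegral_card, Measure.restrict_apply_univ] at hsplit
    have hprod : ∏ i ∈ s, ∫⁻ j, g i j ∂poissonMeasure ((μ.restrict (A a)ᶜ) (A i)).toNNReal =
        ∏ i ∈ s, ∫⁻ j, g i j ∂poissonMeasure (μ (A i)).toNNReal := by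
      refine Finset.prod_congr rfl fun i hi => ?_
      rw [Measure.restrict_eq_self _ (hdis i hi).subset_compl_left]
    rw [hprod] at hsplit
    rw [← hsplit]
    congr 1
    funext m p
    rw [Finset.prod_insert ha, card_indicesIn]
    congr 1
    exact Finset.prod_congr rfl fun i hi => by rw [count_subSample_compl (hdis i hi)]

lemma lintegral_natCast_poissonMeasure (r : ℝ≥0) :
    ∫⁻ j, (j : ℝ≥0∞) ∂poissonMeasure r = r := by
  have h1 := lintegral_poissonMeasure r fun _ => 1
  simp only [lintegral_const, measure_univ, mul_one] at h1
  -- The term at `0` vanishes, and in the others `j / j !` cancels, leaving `r` times the total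
  -- mass.
  rw [lintegral_poissonMeasure, tsum_eq_zero_add' ENNReal.summable]
  simp only [Nat.cast_zero, mul_zero, zero_add]
  rw [← mul_one (r : ℝ≥0∞), h1, ← ENNReal.tsum_mul_left]
  refine tsum_congr fun j => ?_
  rw [← ENNReal.ofReal_coe_nnreal (p := r), ← ENNReal.ofReal_mul (by positivity),
    ← ENNReal.ofReal_natCast, ← ENNReal.ofReal_mul (by positivity)]
  congr 1
  rw [Nat.factorial_succ]
  push_cast
  field_simp
  ring

lemma poissonLintegral_count (μ : Measure X) [IsFiniteMeasure μ] {A : Set X}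
    (hA : MeasurableSet A) : poissonLintegral μ (fun _ p => (count p A : ℝ≥0∞)) = μ A := by
  have := poissonLintegral_prod_count {()} (fun _ => A) (fun _ _ => hA)
    (fun i _ j _ h => absurd (Subsingleton.elim i j) h) (fun _ j => (j : ℝ≥0∞)) μ
  simp only [Finset.prod_singleton] at this
  rw [this, lintegral_natCast_poissonMeasure, ENNReal.coe_toNNReal (measure_ne_top _ _)]

end Poisson

/-! ### Measurability through finitely many distance comparisons -/

section Measurability

variable {d : ℕ}

lemma measurable_sample_iff {β : Type*} [MeasurableSpace β] {h : Sample d → β} :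
    Measurable h ↔ ∀ m, Measurable fun p : Fin m → EuclideanSpace ℝ (Fin d) => h ⟨m, p⟩ :=
  ⟨fun hh _ _ hs => MeasurableSpace.measurableSet_iInf.1 (hh hs) _,
    fun hh _ hs => MeasurableSpace.measurableSet_iInf.2 fun m => hh m hs⟩

lemma measurable_sample_mk (m : ℕ) :
    Measurable fun p : Fin m → EuclideanSpace ℝ (Fin d) => (⟨m, p⟩ : Sample d) :=
  measurable_sample_iff.1 measurable_id m

/-- The nearest neighbour graph in terms of the comparisons of distances from the same point:
`c i j l` says that `l` is closer to `i` than `j` is. -/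
def comparisonGraph {ι : Type*} (k : ℕ) (c : ι → ι → ι → Prop) : SimpleGraph ι where
  Adj i j := (j ≠ i ∧ {l | l ≠ i ∧ c i j l}.ncard < k) ∨ (i ≠ j ∧ {l | l ≠ j ∧ c j i l}.ncard < k)
  symm := ⟨fun _ _ h => h.symm⟩
  loopless := ⟨fun _ h => h.elim (fun h => h.1 rfl) (fun h => h.1 rfl)⟩

lemma measurable_comparison (m : ℕ) :
    Measurable fun (p : Fin m → EuclideanSpace ℝ (Fin d)) (i j l : Fin m) =>
      dist (p i) (p l) < dist (p i) (p j) := by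
  refine measurable_pi_lambda _ fun i => measurable_pi_lambda _ fun j =>
    measurable_pi_lambda _ fun l => ?_
  exact measurableSet_setOfPred.1 (measurableSet_lt (by fun_prop) (by fun_prop))

/-- The count depends on the points only through the distance comparisons and the memberships in
`A`, which take values in a finite discrete space. -/
lemma measurable_card_components_block (k m : ℕ) {A : Set (EuclideanSpace ℝ (Fin d))}
    (hA : MeasurableSet A) :
    Measurable fun p : Fin m → EuclideanSpace ℝ (Fin d) =>
      Nat.card (nnGraph k fun i : {i | p i ∈ A} => p i).ConnectedComponent := by
  have h1 : Measurable fun (p : Fin m → EuclideanSpace ℝ (Fin d)) (i : Fin m) => p i ∈ A :=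
    measurable_pi_lambda _ fun i => measurableSet_setOfPred.1 ((measurable_pi_apply i) hA)
  exact (Measurable.of_discrete (f := fun z : (Fin m → Fin m → Fin m → Prop) × (Fin m → Prop) =>
    Nat.card (comparisonGraph k fun i j l : {i | z.2 i} => z.1 i j l).ConnectedComponent)).comp
      ((measurable_comparison m).prodMk h1)

lemma measurable_card_components (k m : ℕ) :
    Measurable fun p : Fin m → EuclideanSpace ℝ (Fin d) =>
      Nat.card (nnGraph k p).ConnectedComponent :=
  (Measurable.of_discrete (f := fun z : Fin m → Fin m → Fin m → Prop =>
    Nat.card (comparisonGraph k z).ConnectedComponent)).comp (measurable_comparison m)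

lemma measurable_numComponents (k : ℕ) : Measurable (numComponents (d := d) k) :=
  measurable_sample_iff.2 fun m => measurable_card_components k m

lemma measurable_diam_image {m : ℕ} (S : Set (Fin m)) :
    Measurable fun p : Fin m → EuclideanSpace ℝ (Fin d) => Metric.diam (p '' S) := by
  unfold Metric.diam Metric.ediam
  simp only [iSup_image]
  refine Measurable.ennreal_toReal ?_
  refine Measurable.iSup fun i => Measurable.iSup_Prop _ ?_
  refine Measurable.iSup fun j => Measurable.iSup_Prop _ ?_
  exact (measurable_pi_apply i).edist (measurable_pi_apply j)

/-- The sum of the diameters of the images of the components of a graph. -/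
def sumImageDiam {ι X : Type*} [PseudoMetricSpace X] (G : SimpleGraph ι) (p : ι → X) : ℝ :=
  ∑ᶠ C : G.ConnectedComponent, Metric.diam (p '' C.supp)

lemma measurable_sumImageDiam {m : ℕ} (G : SimpleGraph (Fin m)) :
    Measurable fun p : Fin m → EuclideanSpace ℝ (Fin d) => sumImageDiam G p := by
  have : Fintype G.ConnectedComponent := Fintype.ofFinite _
  simp only [sumImageDiam, finsum_eq_sum_of_fintype]
  exact Finset.measurable_fun_sum _ fun C _ => measurable_diam_image _

/-- There are finitely many comparison patterns, and for each fixed pattern the graph is fixed and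
the sum of diameters is measurable in the points. -/
lemma measurable_sumDiam (k : ℕ) : Measurable (sumDiam (d := d) k) := by
  refine measurable_sample_iff.2 fun m => ?_
  have h : Measurable fun z : (Fin m → Fin m → Fin m → Prop) ×
      (Fin m → EuclideanSpace ℝ (Fin d)) => sumImageDiam (comparisonGraph k z.1) z.2 :=
    measurable_from_prod_countable_right fun c =>
      measurable_sumImageDiam (comparisonGraph k c)
  have h' := h.comp ((measurable_comparison m).prodMk measurable_id)
  have heq : ∀ p : Fin m → EuclideanSpace ℝ (Fin d), sumDiam k ⟨m, p⟩ =
      sumImageDiam (comparisonGraph k fun i j l => dist (p i) (p l) < dist (p i) (p j)) p :=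
    fun p => rfl
  simp only [heq]
  exact h'

lemma measurable_meanDiam (k : ℕ) : Measurable (meanDiam (d := d) k) :=
  (measurable_sumDiam k).div (measurable_from_nat.comp (measurable_numComponents k))

end Measurability

/-! ### Monotonicity and linearity of Poisson expectations -/

section PoissonLintegral

variable {X : Type*} [MeasurableSpace X]

lemma poissonLintegral_mono {μ : Measure X} {h₁ h₂ : ∀ m : ℕ, (Fin m → X) → ℝ≥0∞}
    (h : ∀ m, ∀ᵐ p ∂Measure.pi fun _ : Fin m => μ, h₁ m p ≤ h₂ m p) :
    poissonLintegral μ h₁ ≤ poissonLintegral μ h₂ := by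
  unfold poissonLintegral
  refine mul_le_mul_right (ENNReal.tsum_le_tsum fun m => ?_) _
  exact mul_le_mul_right (lintegral_mono_ae (h m)) _

lemma poissonLintegral_add {μ : Measure X} {h₁ h₂ : ∀ m : ℕ, (Fin m → X) → ℝ≥0∞}
    (hh : ∀ m, Measurable (h₁ m)) :
    poissonLintegral μ (fun m p => h₁ m p + h₂ m p) =
      poissonLintegral μ h₁ + poissonLintegral μ h₂ := by
  unfold poissonLintegral
  simp_rw [lintegral_add_left (hh _), mul_add, ENNReal.tsum_add, mul_add]

lemma poissonLintegral_const_mul {μ : Measure X} {h : ∀ m : ℕ, (Fin m → X) → ℝ≥0∞}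
    (hh : ∀ m, Measurable (h m)) (c : ℝ≥0∞) :
    poissonLintegral μ (fun m p => c * h m p) = c * poissonLintegral μ h := by
  unfold poissonLintegral
  simp_rw [lintegral_const_mul _ (hh _), mul_left_comm _ c, ENNReal.tsum_mul_left]
  rw [mul_left_comm]

lemma poissonLintegral_const {μ : Measure X} [IsFiniteMeasure μ] (c : ℝ≥0∞) :
    poissonLintegral μ (fun _ _ => c) = c := by
  have := poissonLintegral_const_mul (μ := μ) (h := fun _ _ => 1) (fun _ => measurable_const) c
  simpa [poissonLintegral_one] using this

lemma poissonLintegral_finsetSum {μ : Measure X} [IsFiniteMeasure μ] {I : Type*} (s : Finset I)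
    {h : I → ∀ m : ℕ, (Fin m → X) → ℝ≥0∞} (hh : ∀ i ∈ s, ∀ m, Measurable (h i m)) :
    poissonLintegral μ (fun m p => ∑ i ∈ s, h i m p) = ∑ i ∈ s, poissonLintegral μ (h i) := by
  classical
  induction s using Finset.induction_on with
  | empty => simpa using poissonLintegral_const (μ := μ) 0
  | insert a s ha ih =>
    simp_rw [Finset.sum_insert ha]
    rw [poissonLintegral_add (hh a (Finset.mem_insert_self a s)),
      ih fun i hi => hh i (Finset.mem_insert_of_mem hi)]

end PoissonLintegral

/-! ### The uniform measure on the cube: boxes, scaling, absence of ties -/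

section Cube

variable {d : ℕ}

instance : IsFiniteMeasure (cubeMeasure d) := by
  constructor
  rw [cubeMeasure, Measure.restrict_apply_univ]
  refine (measure_mono fun x hx => ?_).trans_lt
    (measure_closedBall_lt_top (x := (0 : EuclideanSpace ℝ (Fin d))) (r := √d))
  exact dist_le_of_mem_cube (d := d) hx fun c => by simp

lemma measurableSet_box (a : Fin d → ℝ) (s : ℝ) : MeasurableSet (box a s) := by
  have : box a s = ⋂ c, {x : EuclideanSpace ℝ (Fin d) | x c ∈ Set.Ico (a c) (a c + s)} := by
    ext x; simp [box]
  rw [this]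
  exact MeasurableSet.iInter fun c => measurableSet_Ico.preimage (by fun_prop)

lemma measurableSet_cube : MeasurableSet (cube d) := by
  have : cube d = ⋂ c, {x : EuclideanSpace ℝ (Fin d) | x c ∈ Set.Icc (0 : ℝ) 1} := by
    ext x; simp [cube]
  rw [this]
  exact MeasurableSet.iInter fun c => measurableSet_Icc.preimage (by fun_prop)

lemma box_eq_preimage (a : Fin d → ℝ) (s : ℝ) :
    box a s = WithLp.ofLp ⁻¹' (Set.univ.pi fun c => Set.Ico (a c) (a c + s)) := by
  ext x; simp [box]

lemma volume_box (a : Fin d → ℝ) {s : ℝ} (hs : 0 ≤ s) :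
    volume (box a s) = ENNReal.ofReal (s ^ d) := by
  rw [box_eq_preimage, (PiLp.volume_preserving_ofLp (Fin d)).measure_preimage
    (MeasurableSet.univ_pi fun _ => measurableSet_Ico).nullMeasurableSet, Real.volume_pi_Ico]
  simp [ENNReal.ofReal_pow hs]

/-- The closed and the half-open cube differ by a null set; half-open boxes are used because
adjacent ones are disjoint. -/
lemma cubeMeasure_eq_restrict_box : cubeMeasure d = volume.restrict (box 0 1) := by
  refine Measure.restrict_congr_set ?_
  have h := (PiLp.volume_preserving_ofLp (Fin d)).quasiMeasurePreserving.preimage_ae_eq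
    (Measure.univ_pi_Ico_ae_eq_Icc (μ := fun _ : Fin d => (volume : Measure ℝ))
      (f := 0) (g := 1))
  refine EventuallyEq.trans (EventuallyEq.of_eq ?_) (h.symm.trans (EventuallyEq.of_eq ?_))
  · refine Set.ext fun x => ?_
    simp [Pi.le_def, forall_and]
  · refine Set.ext fun x => ?_
    simp [box]

lemma cubeMeasure_univ : cubeMeasure d Set.univ = 1 := by
  rw [cubeMeasure_eq_restrict_box, Measure.restrict_apply_univ, volume_box _ zero_le_one]
  simp

instance : IsProbabilityMeasure (cubeMeasure d) := ⟨cubeMeasure_univ⟩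

lemma cubeMeasure_box {a : Fin d → ℝ} {s : ℝ} (hs : 0 ≤ s) (h : box a s ⊆ box 0 1) :
    cubeMeasure d (box a s) = ENNReal.ofReal (s ^ d) := by
  rw [cubeMeasure_eq_restrict_box, Measure.restrict_eq_self _ h, volume_box a hs]

/-- The similarity that maps the unit cube to the cube with corner `a` and side length `s`. -/
def scaling (a : Fin d → ℝ) (s : ℝ) (x : EuclideanSpace ℝ (Fin d)) : EuclideanSpace ℝ (Fin d) :=
  s • x + WithLp.toLp 2 a

lemma measurable_scaling (a : Fin d → ℝ) (s : ℝ) : Measurable (scaling a s) := by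
  unfold scaling; fun_prop

lemma dist_scaling (a : Fin d → ℝ) {s : ℝ} (hs : 0 < s) (x y : EuclideanSpace ℝ (Fin d)) :
    dist (scaling a s x) (scaling a s y) = s * dist x y := by
  rw [scaling, scaling, dist_add_right, dist_smul₀, Real.norm_of_nonneg hs.le]

lemma preimage_scaling (a : Fin d → ℝ) {s : ℝ} (hs : 0 < s) :
    scaling a s ⁻¹' box a s = box 0 1 := by
  ext x
  refine forall_congr' fun c => ?_
  have : scaling a s x c = s * x c + a c := by simp [scaling]
  rw [Set.mem_Ico, Set.mem_Ico, this]
  simp only [Pi.zero_apply, zero_add, le_add_iff_nonneg_left, mul_nonneg_iff_of_pos_left hs]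
  refine and_congr_right fun _ => ?_
  constructor
  · intro h; nlinarith
  · intro h; nlinarith

lemma map_scaling (a : Fin d → ℝ) {s : ℝ} (hs : 0 < s) (h : box a s ⊆ box 0 1) :
    (cubeMeasure d).map (scaling a s) =
      ENNReal.ofReal ((s ^ d)⁻¹) • (cubeMeasure d).restrict (box a s) := by
  have hvol : (volume : Measure (EuclideanSpace ℝ (Fin d))).map (scaling a s) =
      ENNReal.ofReal ((s ^ d)⁻¹) • volume := by
    have : scaling a s = (fun x => x + WithLp.toLp 2 a) ∘ fun x => s • x := rfl
    rw [this, ← Measure.map_map (by fun_prop) (by fun_prop), Measure.map_addHaar_smul _ hs.ne',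
      Measure.map_smul, map_add_right_eq_self, finrank_euclideanSpace_fin,
      abs_of_pos (by positivity)]
  rw [cubeMeasure_eq_restrict_box, ← preimage_scaling a hs,
    ← Measure.restrict_map (measurable_scaling a s) (measurableSet_box a s), hvol,
    Measure.restrict_smul, preimage_scaling a hs,
    Measure.restrict_restrict (measurableSet_box a s), Set.inter_eq_left.2 h]

lemma cubeMeasure_absolutelyContinuous : cubeMeasure d ≪ volume :=
  Measure.restrict_le_self.absolutelyContinuous

/-- With all points but `p j` fixed, a tie puts `p j` on the sphere around `p i` through `p l`,
which is a null set. -/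
lemma ae_dist_ne (hd : 1 ≤ d) (μ : Measure (EuclideanSpace ℝ (Fin d))) [IsFiniteMeasure μ]
    (hμ : μ ≪ volume) {m : ℕ} (i j l : Fin m) (hji : j ≠ i) (hjl : j ≠ l) :
    ∀ᵐ p ∂Measure.pi fun _ : Fin m => μ, dist (p i) (p j) ≠ dist (p i) (p l) := by
  have := nontrivial_euclideanSpace hd
  obtain ⟨m, rfl⟩ : ∃ e, m = e + 1 := ⟨m - 1, by have := i.pos; omega⟩
  obtain ⟨a, rfl⟩ := Fin.exists_succAbove_eq hji.symm
  obtain ⟨b, rfl⟩ := Fin.exists_succAbove_eq hjl.symm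
  have hmp := measurePreserving_piFinSuccAbove (fun _ : Fin (m + 1) => μ) j
  set N : Set (EuclideanSpace ℝ (Fin d) × (Fin m → EuclideanSpace ℝ (Fin d))) :=
    {z | dist (z.2 a) z.1 = dist (z.2 a) (z.2 b)} with hN
  have hNm : MeasurableSet N := measurableSet_eq_fun (by fun_prop) (by fun_prop)
  have h0 : (μ.prod (Measure.pi fun _ : Fin m => μ)) N = 0 := by
    rw [Measure.prod_apply_symm hNm]
    refine (lintegral_congr fun y => ?_).trans lintegral_zero
    refine hμ (measure_mono_null ?_
      (Measure.addHaar_sphere volume (y a) (dist (y a) (y b))))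
    intro x hx
    rw [Metric.mem_sphere, dist_comm]
    exact hx
  rw [ae_iff]
  simp only [ne_eq, not_not]
  exact (hmp.measure_preimage hNm.nullMeasurableSet).trans h0

lemma ae_no_ties (hd : 1 ≤ d) (μ : Measure (EuclideanSpace ℝ (Fin d))) [IsFiniteMeasure μ]
    (hμ : μ ≪ volume) (m : ℕ) :
    ∀ᵐ p ∂Measure.pi fun _ : Fin m => μ, ∀ i j l, j ≠ i → l ≠ i → j ≠ l →
      dist (p i) (p j) ≠ dist (p i) (p l) := by
  simp only [ae_all_iff]
  exact fun i j l hji _ hjl => ae_dist_ne hd μ hμ i j l hji hjl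

end Cube

/-! ### From the Poisson law to Poisson expectations; integrability -/

section Law

variable {d : ℕ}

open scoped Nat in
-- The factor `n ^ m` of the Poisson weight is absorbed into the product measure of `n • cubeMeasure
-- d`.
lemma lintegral_poissonLaw (n : ℝ≥0) {h : Sample d → ℝ≥0∞} (hh : Measurable h) :
    ∫⁻ ω, h ω ∂poissonLaw d n = poissonLintegral (n • cubeMeasure d) fun m p => h ⟨m, p⟩ := by
  rw [poissonLaw, lintegral_sum_measure, poissonLintegral, ← ENNReal.tsum_mul_left]
  refine tsum_congr fun m => ?_
  have hpi : (Measure.pi fun _ : Fin m => n • cubeMeasure d) =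
      (n ^ m) • Measure.pi fun _ : Fin m => cubeMeasure d := by
    refine Measure.pi_eq fun s _ => ?_
    rw [Measure.smul_apply, Measure.pi_pi]
    simp only [Measure.smul_apply, ENNReal.smul_def, smul_eq_mul, Finset.prod_mul_distrib,
      Finset.prod_const, Finset.card_univ, Fintype.card_fin, ENNReal.coe_pow]
  rw [lintegral_smul_measure, lintegral_map hh (measurable_sample_mk m), hpi,
    lintegral_smul_measure, poissonMeasure_singleton]
  have hu : ((n • cubeMeasure d) Set.univ).toReal = n := by
    rw [Measure.smul_apply, cubeMeasure_univ, ENNReal.smul_def]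
    simp
  rw [hu, mul_div_assoc, ENNReal.ofReal_mul (Real.exp_pos _).le,
    ENNReal.ofReal_div_of_pos (by positivity), ENNReal.ofReal_pow (by positivity),
    ENNReal.ofReal_natCast, ENNReal.ofReal_coe_nnreal, ENNReal.div_eq_inv_mul,
    smul_eq_mul, ENNReal.smul_def, smul_eq_mul, ENNReal.coe_pow]
  ring

instance (n : ℝ≥0) : IsProbabilityMeasure (poissonLaw d n) := by
  constructor
  have := lintegral_poissonLaw (d := d) n (h := fun _ => 1) measurable_const
  simpa [poissonLintegral_one] using this

lemma measurableSet_forall_mem_cube (m : ℕ) :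
    MeasurableSet {p : Fin m → EuclideanSpace ℝ (Fin d) | ∀ i, p i ∈ cube d} := by
  simp only [Set.ofPred_forall]
  exact MeasurableSet.iInter fun i => (measurable_pi_apply i) measurableSet_cube

lemma ae_mem_cube (n : ℝ≥0) : ∀ᵐ ω ∂poissonLaw d n, ∀ i, ω.2 i ∈ cube d := by
  have hmeas : MeasurableSet {ω : Sample d | ∀ i, ω.2 i ∈ cube d} :=
    MeasurableSpace.measurableSet_iInf.2 fun m => measurableSet_forall_mem_cube m
  have h : ∫⁻ ω, {ω : Sample d | ∀ i, ω.2 i ∈ cube d}ᶜ.indicator 1 ω ∂poissonLaw d n = 0 := by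
    rw [lintegral_poissonLaw n (measurable_one.indicator hmeas.compl), ← nonpos_iff_eq_zero,
      ← poissonLintegral_const (μ := n • cubeMeasure d) 0]
    refine poissonLintegral_mono fun m => ?_
    have h1 : ∀ᵐ x ∂(n • cubeMeasure d), x ∈ cube d :=
      Measure.ae_smul_measure (ae_restrict_mem measurableSet_cube) n
    have h2 : ∀ᵐ p ∂Measure.pi fun _ : Fin m => n • cubeMeasure d, ∀ i, p i ∈ cube d :=
      ae_all_iff.2 fun i => Measure.tendsto_eval_ae_ae.eventually h1
    filter_upwards [h2] with p hp
    rw [Set.indicator_of_notMem]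
    exact fun hcon => hcon hp
  rw [lintegral_indicator_one hmeas.compl] at h
  exact h

/-- The expected number of components. -/
def expComponents (d k : ℕ) (n : ℝ≥0) : ℝ≥0∞ :=
  poissonLintegral (n • cubeMeasure d) fun _ p => (Nat.card (nnGraph k p).ConnectedComponent : ℝ≥0∞)

lemma lintegral_numComponents (k : ℕ) (n : ℝ≥0) :
    ∫⁻ ω, (numComponents k ω : ℝ≥0∞) ∂poissonLaw d n = expComponents d k n :=
  lintegral_poissonLaw n (measurable_from_nat.comp (measurable_numComponents k))

lemma lintegral_card (n : ℝ≥0) : ∫⁻ ω : Sample d, (ω.1 : ℝ≥0∞) ∂poissonLaw d n = n := by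
  have hm : Measurable fun ω : Sample d => (ω.1 : ℝ≥0∞) :=
    measurable_sample_iff.2 fun m => measurable_const (a := (m : ℝ≥0∞))
  rw [lintegral_poissonLaw n hm]
  have h := poissonLintegral_count (n • cubeMeasure d) MeasurableSet.univ
  have hc : ∀ m (p : Fin m → EuclideanSpace ℝ (Fin d)), count p Set.univ = m := fun m p => by
    rw [← card_indicesIn]
    simp [indicesIn]
  simp only [hc] at h
  rw [h, Measure.smul_apply, cubeMeasure_univ, ENNReal.smul_def, smul_eq_mul, mul_one]

lemma card_components_le {V : Type*} [Finite V] (G : SimpleGraph V) :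
    Nat.card G.ConnectedComponent ≤ Nat.card V :=
  Nat.card_le_card_of_surjective G.connectedComponentMk Quot.mk_surjective

lemma numComponents_le (k : ℕ) (ω : Sample d) : numComponents k ω ≤ ω.1 :=
  (card_components_le _).trans_eq (by simp)

lemma expComponents_le (k : ℕ) (n : ℝ≥0) : expComponents d k n ≤ n := by
  rw [← lintegral_numComponents, ← lintegral_card (d := d) n]
  exact lintegral_mono fun ω => Nat.cast_le.2 (numComponents_le k ω)

lemma expComponents_ne_top (k : ℕ) (n : ℝ≥0) : expComponents d k n ≠ ⊤ :=
  ((expComponents_le k n).trans_lt ENNReal.coe_lt_top).ne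

lemma integrable_card (n : ℝ≥0) : Integrable (fun ω : Sample d => (ω.1 : ℝ)) (poissonLaw d n) := by
  have hm : Measurable fun ω : Sample d => (ω.1 : ℝ) :=
    measurable_sample_iff.2 fun m => measurable_const (a := (m : ℝ))
  refine ⟨hm.aestronglyMeasurable, ?_⟩
  rw [hasFiniteIntegral_iff_norm]
  simp [lintegral_card]

lemma integral_card (n : ℝ≥0) : ∫ ω : Sample d, (ω.1 : ℝ) ∂poissonLaw d n = n := by
  rw [integral_eq_lintegral_of_nonneg_ae (ae_of_all _ fun ω => Nat.cast_nonneg _)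
    (integrable_card n).aestronglyMeasurable]
  simp [lintegral_card]

lemma integrable_numComponents (k : ℕ) (n : ℝ≥0) :
    Integrable (fun ω : Sample d => (numComponents k ω : ℝ)) (poissonLaw d n) :=
  (integrable_card n).mono
    (measurable_from_nat.comp (measurable_numComponents k)).aestronglyMeasurable
    (ae_of_all _ fun ω => by simpa using numComponents_le k ω)

lemma integral_numComponents (k : ℕ) (n : ℝ≥0) :
    ∫ ω : Sample d, (numComponents k ω : ℝ) ∂poissonLaw d n = (expComponents d k n).toReal := by
  rw [integral_eq_lintegral_of_nonneg_ae (ae_of_all _ fun ω => Nat.cast_nonneg _)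
    (integrable_numComponents k n).aestronglyMeasurable]
  simp [lintegral_numComponents]

end Law

/-! ### Almost additivity of the expected number of components -/

section Comparison

variable {d : ℕ}

/-- The points in a small cube look like a Poisson process on the unit cube. -/
lemma poissonLintegral_components_box (k : ℕ) {n n' : ℝ≥0} {a : Fin d → ℝ} {s : ℝ} (hs : 0 < s)
    (ha : box a s ⊆ box 0 1) (hn : (n : ℝ) = n' * s ^ d) :
    poissonLintegral (n' • cubeMeasure d) (fun _ p =>
      (Nat.card (nnGraph k fun i : {i | p i ∈ box a s} => p i).ConnectedComponent : ℝ≥0∞)) =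
      expComponents d k n := by
  set h : ∀ m : ℕ, (Fin m → EuclideanSpace ℝ (Fin d)) → ℝ≥0∞ := fun _ p =>
    (Nat.card (nnGraph k p).ConnectedComponent : ℝ≥0∞) with hh
  have hm : ∀ m, Measurable (h m) := fun m =>
    measurable_from_nat.comp (measurable_card_components k m)
  have h1 : ∀ m (p : Fin m → EuclideanSpace ℝ (Fin d)),
      (Nat.card (nnGraph k fun i : {i | p i ∈ box a s} => p i).ConnectedComponent : ℝ≥0∞) =
        h _ (subSample p (indicesIn (box a s) p)) := by
    intro m p
    rw [hh]
    congr 1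
    refine card_components_nnGraph_congr k
      ((Equiv.subtypeEquivRight fun i => (mem_indicesIn (A := box a s) (p := p)).symm).trans
        (indicesIn (box a s) p).equivFin) _ _ ?_
    intro i j l
    simp [subSample]
  -- Scaling spreads the mass `n` over volume `s ^ d`, which is density `n' = n / s ^ d`; distance
  -- comparisons, and with them the graph, are scale invariant.
  have h2 : n • (cubeMeasure d).map (scaling a s) = (n' • cubeMeasure d).restrict (box a s) := by
    have : (n : ℝ≥0∞) * ENNReal.ofReal ((s ^ d)⁻¹) = n' := by
      rw [← ENNReal.ofReal_coe_nnreal, ← ENNReal.ofReal_mul (by positivity), hn,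
        mul_assoc, mul_inv_cancel₀ (by positivity), mul_one, ENNReal.ofReal_coe_nnreal]
    rw [map_scaling a hs ha, Measure.restrict_smul, ENNReal.smul_def, smul_smul, this]
    rfl
  simp_rw [h1]
  rw [poissonLintegral_restrict _ (measurableSet_box a s) h hm, ← h2]
  have h3 : n • (cubeMeasure d).map (scaling a s) = (n • cubeMeasure d).map (scaling a s) := by
    rw [Measure.map_smul]
  rw [h3, poissonLintegral_map _ (measurable_scaling a s) h hm, expComponents]
  congr 1
  funext m p
  refine congrArg (fun x : ℕ => (x : ℝ≥0∞)) ?_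
  refine (card_components_nnGraph_congr k (Equiv.refl _) p (fun i => scaling a s (p i))
    fun i j l => ?_).symm
  simp only [Equiv.refl_apply, dist_scaling a hs]
  exact mul_lt_mul_iff_right₀ hs

/-- The cells of a grid of `J ^ d` cubes of side length `s`. -/
def cellIndex {J : ℕ} (q : Fin d → Fin J) : Fin d → ℤ := fun c => ((q c : ℕ) : ℤ)

lemma cellIndex_injective {J : ℕ} :
    Function.Injective (cellIndex : (Fin d → Fin J) → Fin d → ℤ) := fun _ _ h =>
  funext fun c => Fin.ext (Int.ofNat_inj.1 (congrFun h c))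

lemma gridCube_subset_box {J : ℕ} {s : ℝ} (hs : 0 ≤ s) (hJ : J * s ≤ 1) (q : Fin d → Fin J) :
    gridCube s (cellIndex q) ⊆ box 0 1 := by
  intro x hx c
  have h1 := gridCube_coord hx c
  have h2 : ((q c : ℕ) : ℝ) + 1 ≤ J := by exact_mod_cast (q c).2
  have h3 : (cellIndex q c : ℝ) = ((q c : ℕ) : ℝ) := by simp [cellIndex]
  rw [h3] at h1
  have h4 : 0 ≤ s * ((q c : ℕ) : ℝ) := by positivity
  rw [Pi.zero_apply, zero_add]
  constructor
  · linarith [h1.1]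
  · nlinarith [h1.2, mul_le_mul_of_nonneg_right h2 hs]

/-- The expected number of points near the boundaries of the cells, including those in the part of
the cube that the grid does not cover. -/
lemma measure_compl_inner (n : ℝ≥0) {J : ℕ} {s t : ℝ} (hs : 0 < s) (ht : 0 < t) (ht' : 2 * t < 1)
    (hJ : J * s ≤ 1) :
    (n • cubeMeasure d) (⋃ q : Fin d → Fin J,
      box (fun c => s * cellIndex q c + t * s) (s - 2 * (t * s)))ᶜ =
      ENNReal.ofReal (n * (1 - J ^ d * (s * (1 - 2 * t)) ^ d)) := by
  set B : (Fin d → Fin J) → Set (EuclideanSpace ℝ (Fin d)) := fun q =>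
    box (fun c => s * cellIndex q c + t * s) (s - 2 * (t * s)) with hB
  have hBsub : ∀ q, B q ⊆ gridCube s (cellIndex q) := fun q x hx =>
    ball_subset_box hx (Metric.mem_ball_self (mul_pos ht hs))
  have hBm : ∀ q, MeasurableSet (B q) := fun q => measurableSet_box _ _
  have hvol : cubeMeasure d (⋃ q, B q) = ENNReal.ofReal (J ^ d * (s * (1 - 2 * t)) ^ d) := by
    rw [measure_iUnion (fun q r hqr => (gridCube_disjoint hs (cellIndex_injective.ne hqr)).mono
      (hBsub q) (hBsub r)) hBm, tsum_fintype]
    have h1 : ∀ q, cubeMeasure d (B q) = ENNReal.ofReal ((s * (1 - 2 * t)) ^ d) := by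
      intro q
      rw [hB]
      simp only
      rw [cubeMeasure_box (by nlinarith) ((hBsub q).trans (gridCube_subset_box hs.le hJ q))]
      ring_nf
    rw [Finset.sum_congr rfl fun q _ => h1 q, Finset.sum_const, Finset.card_univ, nsmul_eq_mul,
      Fintype.card_fun, Fintype.card_fin, Fintype.card_fin, ← ENNReal.ofReal_natCast,
      ← ENNReal.ofReal_mul (by positivity)]
    push_cast
    rfl
  rw [Measure.smul_apply, prob_compl_eq_one_sub (MeasurableSet.iUnion hBm), hvol,
    ← ENNReal.ofReal_one, ← ENNReal.ofReal_sub _ (by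
      have : 0 ≤ s * (1 - 2 * t) := mul_nonneg hs.le (by linarith)
      positivity), ENNReal.smul_def, smul_eq_mul, ← ENNReal.ofReal_coe_nnreal,
    ← ENNReal.ofReal_mul (by positivity)]

/-- The expected number of components is almost additive over the cells of a grid. -/
lemma expComponents_comparison (hd : 1 ≤ d) (k : ℕ) {n n' : ℝ≥0} {J : ℕ} {s t : ℝ} (hs : 0 < s)
    (ht : 0 < t) (ht' : 2 * t < 1) (hJ : J * s ≤ 1) (hn : (n : ℝ) = n' * s ^ d) :
    |(expComponents d k n').toReal - J ^ d * (expComponents d k n).toReal| ≤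
      (k + 1) * (n' * (1 - J ^ d * (s * (1 - 2 * t)) ^ d) +
        J ^ d * (k * (4 * √d) ^ d * (1 / t) ^ d)) := by
  set μ := n' • cubeMeasure d with hμ
  have hμac : μ ≪ volume :=
    (Measure.smul_absolutelyContinuous (c := n')).trans cubeMeasure_absolutelyContinuous
  have hst : 0 < t * s := mul_pos ht hs
  have hstle : t * s ≤ s := by nlinarith
  set A : (Fin d → Fin J) → Set (EuclideanSpace ℝ (Fin d)) := fun q =>
    box (fun c => s * cellIndex q c) s with hA
  set B : (Fin d → Fin J) → Set (EuclideanSpace ℝ (Fin d)) := fun q =>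
    box (fun c => s * cellIndex q c + t * s) (s - 2 * (t * s)) with hB
  set M : ℝ := J ^ d * (k * (4 * √d) ^ d * (1 / t) ^ d) with hM
  have hM0 : 0 ≤ M := by positivity
  set F : ∀ m : ℕ, (Fin m → EuclideanSpace ℝ (Fin d)) → ℝ≥0∞ := fun m p =>
    (Nat.card (nnGraph k p).ConnectedComponent : ℝ≥0∞) with hF
  set H : (Fin d → Fin J) → ∀ m : ℕ, (Fin m → EuclideanSpace ℝ (Fin d)) → ℝ≥0∞ := fun q m p =>
    (Nat.card (nnGraph k fun i : {i | p i ∈ A q} => p i).ConnectedComponent : ℝ≥0∞) with hH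
  -- `R` dominates `k + 1` times the number of unsettled points: the points outside the inner cells,
  -- plus the deterministic bound `M` on the sparse ones.
  set R : ∀ m : ℕ, (Fin m → EuclideanSpace ℝ (Fin d)) → ℝ≥0∞ := fun m p =>
    (k + 1) * ((count p (⋃ q, B q)ᶜ : ℝ≥0∞) + ENNReal.ofReal M) with hR
  have hFm : ∀ m, Measurable (F m) := fun m =>
    measurable_from_nat.comp (measurable_card_components k m)
  have hHm : ∀ q m, Measurable (H q m) := fun q m =>
    measurable_from_nat.comp (measurable_card_components_block k m (measurableSet_box _ _))
  have hcm : ∀ m, Measurable fun p : Fin m → EuclideanSpace ℝ (Fin d) =>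
      (count p (⋃ q, B q)ᶜ : ℝ≥0∞) := fun m =>
    measurable_from_nat.comp
      (measurable_count (MeasurableSet.iUnion fun q => measurableSet_box _ _).compl)
  have hpt : ∀ m, ∀ᵐ p ∂Measure.pi fun _ : Fin m => μ,
      F m p ≤ ∑ q, H q m p + R m p ∧ ∑ q, H q m p ≤ F m p + R m p := by
    intro m
    filter_upwards [ae_no_ties hd μ hμac m] with p hp
    have h1 := components_block_comparison k p A B hst
      (fun q r hqr => gridCube_disjoint hs (cellIndex_injective.ne hqr))
      (fun q x hx => ball_subset_box hx) hp
    have h2 : ((unsettled k p A B (t * s)).ncard : ℝ) ≤ count p (⋃ q, B q)ᶜ + M := by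
      have h3 := ncard_unsettled_le hd k p
        (fun (q : Fin d → Fin J) c => s * cellIndex q c) hst hstle
      refine h3.trans_eq ?_
      rw [hM, Fintype.card_fun, Fintype.card_fin, Fintype.card_fin]
      have h4 : s / (t * s) = 1 / t := by field_simp
      rw [h4]
      push_cast
      rfl
    have h3 : ((k + 1 : ℕ) : ℝ≥0∞) * ((unsettled k p A B (t * s)).ncard : ℝ≥0∞) ≤ R m p := by
      rw [hR]
      push_cast
      gcongr
      rw [← ENNReal.ofReal_natCast, ← ENNReal.ofReal_natCast,
        ← ENNReal.ofReal_add (Nat.cast_nonneg _) hM0]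
      exact ENNReal.ofReal_le_ofReal h2
    constructor
    · refine le_trans ?_ (add_le_add_right h3 _)
      simp only [hF, hH]
      exact_mod_cast h1.1
    · refine le_trans ?_ (add_le_add_right h3 _)
      simp only [hF, hH]
      exact_mod_cast h1.2
  have hpR : poissonLintegral μ R =
      ENNReal.ofReal ((k + 1) * (n' * (1 - J ^ d * (s * (1 - 2 * t)) ^ d) + M)) := by
    have h0 : 0 ≤ (n' : ℝ) * (1 - J ^ d * (s * (1 - 2 * t)) ^ d) := by
      refine mul_nonneg n'.2 (sub_nonneg.2 ?_)
      rw [← mul_pow]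
      refine pow_le_one₀ (by have : 0 ≤ 1 - 2 * t := by linarith
                             positivity) ?_
      have : 0 ≤ (J : ℝ) * s := by positivity
      nlinarith
    rw [hR, poissonLintegral_const_mul (fun m => (hcm m).add_const _),
      poissonLintegral_add hcm, poissonLintegral_const,
      poissonLintegral_count _ (MeasurableSet.iUnion fun q => measurableSet_box _ _).compl,
      measure_compl_inner n' hs ht ht' hJ, ← ENNReal.ofReal_add h0 hM0,
      ENNReal.ofReal_mul (by positivity), ENNReal.ofReal_add (Nat.cast_nonneg _) zero_le_one,
      ENNReal.ofReal_natCast, ENNReal.ofReal_one]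
  have hRm : ∀ m, Measurable (R m) := fun m => ((hcm m).add_const _).const_mul _
  have hpH : poissonLintegral μ (fun m p => ∑ q, H q m p) = J ^ d * expComponents d k n := by
    rw [poissonLintegral_finsetSum _ fun q _ m => hHm q m]
    have : ∀ q, poissonLintegral μ (H q) = expComponents d k n := fun q =>
      poissonLintegral_components_box k hs (gridCube_subset_box hs.le hJ q) hn
    simp [this]
  have hle1 : expComponents d k n' ≤ J ^ d * expComponents d k n + poissonLintegral μ R := by
    rw [← hpH, ← poissonLintegral_add fun m => Finset.measurable_fun_sum _ fun q _ => hHm q m]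
    exact poissonLintegral_mono fun m => (hpt m).mono fun p hp => hp.1
  have hle2 : J ^ d * expComponents d k n ≤ expComponents d k n' + poissonLintegral μ R := by
    rw [← hpH, expComponents, ← poissonLintegral_add hFm]
    exact poissonLintegral_mono fun m => (hpt m).mono fun p hp => hp.2
  have hE : 0 ≤ (k + 1) * (n' * (1 - J ^ d * (s * (1 - 2 * t)) ^ d) + M) := by
    refine mul_nonneg (by positivity) (add_nonneg (mul_nonneg n'.2 (sub_nonneg.2 ?_)) hM0)
    rw [← mul_pow]
    refine pow_le_one₀ (by have : 0 ≤ 1 - 2 * t := by linarith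
                           positivity) ?_
    have : 0 ≤ (J : ℝ) * s := by positivity
    nlinarith
  rw [hpR] at hle1 hle2
  have hJtop : (J : ℝ≥0∞) ^ d * expComponents d k n ≠ ⊤ :=
    ENNReal.mul_ne_top (by finiteness) (expComponents_ne_top k n)
  have hr1 := ENNReal.toReal_mono (by finiteness) hle1
  have hr2 := ENNReal.toReal_mono (by have := expComponents_ne_top (d := d) k n'; finiteness) hle2
  rw [ENNReal.toReal_add hJtop (by finiteness), ENNReal.toReal_ofReal hE] at hr1
  rw [ENNReal.toReal_add (expComponents_ne_top k n') (by finiteness),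
    ENNReal.toReal_ofReal hE] at hr2
  have hJr : ((J : ℝ≥0∞) ^ d * expComponents d k n).toReal =
      J ^ d * (expComponents d k n).toReal := by simp
  rw [hJr] at hr1 hr2
  rw [abs_le]
  constructor <;> linarith

end Comparison

/-! ### Existence of the limit -/

section Limit

variable {d : ℕ}

/-- Cells of side `1 / x` have expected number of points `n`, and `⌊x⌋₊` of them fit along each
axis; `a` is the fraction of the cube that they fill, so there are `a * (n' / n)` cells. The final
`1 - a` uses that there are at most `n` components in expectation. -/
lemma expComponents_div_comparison (hd : 1 ≤ d) (k : ℕ) {n n' : ℝ≥0} (hn : 0 < n) (hn' : 0 < n')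
    {t : ℝ} (ht : 0 < t) (ht' : 2 * t < 1) {x a : ℝ} (hx : x = ((n' : ℝ) / n) ^ (1 / (d : ℝ)))
    (ha : a = ((⌊x⌋₊ : ℝ) / x) ^ d) :
    |(expComponents d k n').toReal / n' - (expComponents d k n).toReal / n| ≤
      (k + 1) * (1 - a * (1 - 2 * t) ^ d + a * (k * (4 * √d) ^ d * (1 / t) ^ d) / n) +
        (1 - a) := by
  have hnr : (0 : ℝ) < n := hn
  have hn'r : (0 : ℝ) < n' := hn'
  have hx0 : 0 < x := by rw [hx]; positivity
  have hxd : x ^ d = n' / n := by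
    rw [hx, ← Real.rpow_natCast, ← Real.rpow_mul (by positivity), one_div,
      inv_mul_cancel₀ (by exact_mod_cast (by omega : d ≠ 0)), Real.rpow_one]
  have hfl : (⌊x⌋₊ : ℝ) ≤ x := Nat.floor_le hx0.le
  have hJ : (⌊x⌋₊ : ℝ) * x⁻¹ ≤ 1 := by
    rw [← div_eq_mul_inv]; exact div_le_one_of_le₀ hfl hx0.le
  have hcomp := expComponents_comparison (n := n) (n' := n') hd k (inv_pos.2 hx0) ht ht' hJ (by
    rw [inv_pow, hxd]; field_simp)
  set K : ℝ := k * (4 * √d) ^ d * (1 / t) ^ d with hK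
  set F' := (expComponents d k n').toReal
  set F := (expComponents d k n).toReal with hF
  have haJ : (⌊x⌋₊ : ℝ) ^ d = a * (n' / n) := by
    rw [ha, div_pow, hxd]; field_simp
  have ha0 : 0 ≤ a := by rw [ha]; positivity
  have ha1 : a ≤ 1 := by
    rw [ha]
    exact pow_le_one₀ (by positivity) (div_le_one_of_le₀ hfl hx0.le)
  have hF0 : 0 ≤ F := ENNReal.toReal_nonneg
  have hFn : F ≤ n := by
    have := ENNReal.toReal_mono ENNReal.coe_ne_top (expComponents_le (d := d) k n)
    simpa using this
  rw [mul_pow, inv_pow, hxd, haJ] at hcomp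
  have h1 : |F' / n' - a * (F / n)| ≤
      (k + 1) * (1 - a * (1 - 2 * t) ^ d + a * K / n) := by
    have e1 : F' / n' - a * (F / n) = (F' - a * (n' / n) * F) / n' := by field_simp
    rw [e1, abs_div, abs_of_pos hn'r, div_le_iff₀ hn'r]
    refine hcomp.trans_eq ?_
    field_simp
  have h2 : |a * (F / n) - F / n| ≤ 1 - a := by
    have : F / n ≤ 1 := div_le_one_of_le₀ hFn hnr.le
    have h0 : 0 ≤ F / n := by positivity
    rw [abs_le]
    constructor <;> nlinarith
  calc |F' / n' - F / n| ≤ |F' / n' - a * (F / n)| + |a * (F / n) - F / n| :=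
        abs_sub_le _ _ _
    _ ≤ _ := add_le_add h1 h2

lemma tendsto_floor_ratio (hd : 1 ≤ d) {n : ℝ≥0} (hn : 0 < n) :
    Tendsto (fun n' : ℝ≥0 => ((⌊((n' : ℝ) / n) ^ (1 / (d : ℝ))⌋₊ : ℝ) /
      ((n' : ℝ) / n) ^ (1 / (d : ℝ))) ^ d) atTop (𝓝 1) := by
  have h1 : Tendsto (fun n' : ℝ≥0 => ((n' : ℝ) / n) ^ (1 / (d : ℝ))) atTop atTop := by
    refine (tendsto_rpow_atTop (by positivity)).comp ?_
    exact (NNReal.tendsto_coe_atTop.2 tendsto_id).atTop_div_const hn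
  have h2 := ((tendsto_nat_floor_div_atTop (R := ℝ)).comp h1).pow d
  simpa using h2

/-- The parameters are chosen in order: `t` makes the boundary layers thin, then `n`, depending on
`t`, makes the constant per cell negligible, and finally `n' → ∞` sends the filled fraction to `1`.
-/
lemma eventually_close (hd : 1 ≤ d) (k : ℕ) {ε : ℝ} (hε : 0 < ε) :
    ∃ n : ℝ≥0, ∀ᶠ n' : ℝ≥0 in atTop,
      |(expComponents d k n').toReal / n' - (expComponents d k n).toReal / n| < ε := by
  obtain ⟨t, ht, ht', hte⟩ : ∃ t : ℝ, 0 < t ∧ 2 * t < 1 ∧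
      (k + 1) * (1 - (1 - 2 * t) ^ d) < ε / 2 := by
    have h1 : Tendsto (fun t : ℝ => (k + 1) * (1 - (1 - 2 * t) ^ d)) (𝓝[>] 0) (𝓝 0) := by
      have : Continuous fun t : ℝ => ((k : ℝ) + 1) * (1 - (1 - 2 * t) ^ d) := by fun_prop
      simpa using (this.tendsto 0).mono_left nhdsWithin_le_nhds
    have h2 : ∀ᶠ t : ℝ in 𝓝[>] 0, 2 * t < 1 := by
      have : Tendsto (fun t : ℝ => 2 * t) (𝓝[>] 0) (𝓝 0) := by
        have : Continuous fun t : ℝ => 2 * t := by fun_prop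
        simpa using (this.tendsto 0).mono_left nhdsWithin_le_nhds
      exact this.eventually (gt_mem_nhds one_pos)
    obtain ⟨t, h3, h4, h5⟩ := ((eventually_mem_nhdsWithin (a := (0 : ℝ)) (s := Set.Ioi 0)).and
      (h2.and (h1.eventually (gt_mem_nhds (half_pos hε))))).exists
    exact ⟨t, h3, h4, h5⟩
  set K : ℝ := k * (4 * √d) ^ d * (1 / t) ^ d with hK
  have hK0 : 0 ≤ K := by positivity
  -- Chosen so that `(k + 1) * (K / n) < ε / 2`; the summand `1` keeps `n` positive.
  set n : ℝ≥0 := ⟨2 * (k + 1) * K / ε + 1, by positivity⟩ with hn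
  have hnr : (n : ℝ) = 2 * (k + 1) * K / ε + 1 := rfl
  have hn0 : 0 < n := by
    rw [← NNReal.coe_pos, hnr]; positivity
  have hnr0 : (0 : ℝ) < n := hn0
  have hKn : (k + 1) * (K / n) < ε / 2 := by
    rw [← mul_div_assoc, div_lt_iff₀ hnr0, hnr]
    have : ε / 2 * (2 * (k + 1) * K / ε + 1) = (k + 1) * K + ε / 2 := by field_simp
    rw [this]
    linarith
  refine ⟨n, ?_⟩
  have hcont : Tendsto (fun a : ℝ => (k + 1) * (1 - a * (1 - 2 * t) ^ d + a * K / n) + (1 - a))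
      (𝓝 1) (𝓝 ((k + 1) * (1 - 1 * (1 - 2 * t) ^ d + 1 * K / n) + (1 - 1))) := by
    have : Continuous fun a : ℝ =>
        ((k : ℝ) + 1) * (1 - a * (1 - 2 * t) ^ d + a * K / n) + (1 - a) := by fun_prop
    exact this.tendsto 1
  have hlt : (k + 1) * (1 - 1 * (1 - 2 * t) ^ d + 1 * K / n) + (1 - 1) < ε := by
    have : (k + 1) * (1 - 1 * (1 - 2 * t) ^ d + 1 * K / n) + (1 - 1) =
        (k + 1) * (1 - (1 - 2 * t) ^ d) + (k + 1) * (K / n) := by ring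
    rw [this]
    linarith
  filter_upwards [(hcont.comp (tendsto_floor_ratio hd hn0)).eventually (gt_mem_nhds hlt),
    eventually_gt_atTop 0] with n' h1 h2
  exact (expComponents_div_comparison hd k hn0 h2 ht ht' rfl rfl).trans_lt h1

/-- All late values are close to one reference value, hence close to each other, which is the Cauchy
property. -/
lemma exists_tendsto_expComponents_div (hd : 1 ≤ d) (k : ℕ) :
    ∃ c : ℝ, Tendsto (fun n : ℝ≥0 => (expComponents d k n).toReal / n) atTop (𝓝 c) := by
  refine cauchySeq_tendsto_of_complete (Metric.cauchySeq_iff'.2 fun ε hε => ?_)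
  obtain ⟨n, hn⟩ := eventually_close hd k (half_pos hε)
  obtain ⟨N, hN⟩ := eventually_atTop.1 hn
  refine ⟨N, fun n' hn' => ?_⟩
  have h1 := hN n' hn'
  have h2 := hN N le_rfl
  rw [← Real.dist_eq] at h1 h2
  linarith [dist_triangle_right ((expComponents d k n').toReal / n')
    ((expComponents d k N).toReal / N) ((expComponents d k n).toReal / n)]

end Limit

/-! ### Linearly many components with high probability -/

section Concentration

variable {d : ℕ}

/-- The grid cube with position `o` inside the block of `W ^ d` grid cubes with index `q`. -/
def blockIndex {J W : ℕ} (q : Fin d → Fin J) (o : Fin d → Fin W) : Fin d → Fin (J * W) :=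
  fun c => finProdFinEquiv (q c, o c)

lemma blockIndex_injective {J W : ℕ} :
    Function.Injective fun z : (Fin d → Fin J) × (Fin d → Fin W) => blockIndex z.1 z.2 := by
  rintro ⟨q, o⟩ ⟨q', o'⟩ h
  have h1 : ∀ c, (q c, o c) = (q' c, o' c) := fun c => finProdFinEquiv.injective (congrFun h c)
  simp only [Prod.mk.injEq] at h1
  exact Prod.ext (funext fun c => (h1 c).1) (funext fun c => (h1 c).2)

/-- The side length of the blocks of grid cubes in the definition of separated cubes. -/
abbrev blockSide (d : ℕ) : ℕ := 2 * (d + 2) + 1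

/-- The position in the centre of a block. -/
def centre (d : ℕ) : Fin d → Fin (blockSide d) := fun _ => ⟨d + 2, by unfold blockSide; omega⟩

open scoped Classical in
/-- The admissible numbers of points at a position of a block. -/
def admissible (d k : ℕ) (o : Fin d → Fin (blockSide d)) : Set ℕ :=
  if o = centre d ∨ ∃ c, (o c : ℕ) = 0 ∨ (o c : ℕ) = 2 * (d + 2) then {j | k + 1 ≤ j} else {0}

/-- The centre of the block `q` is separated, in terms of the numbers of points in grid cubes. -/
def separatedEvent (k J : ℕ) (δ : ℝ) (q : Fin d → Fin J) : Set (Sample d) :=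
  {ω | ∀ o : Fin d → Fin (blockSide d),
    count ω.2 (gridCube δ (cellIndex (blockIndex q o))) ∈ admissible d k o}

lemma cellIndex_blockIndex {J : ℕ} (q : Fin d → Fin J) (o : Fin d → Fin (blockSide d)) (c : Fin d) :
    cellIndex (blockIndex q o) c = (o c : ℕ) + (blockSide d : ℤ) * (q c : ℕ) := by
  simp [cellIndex, blockIndex]

/-- The grid cubes within distance `d + 2` of the centre are exactly those of the block, and
distance exactly `d + 2` means that a coordinate is at an end of the block. -/
lemma isSeparated_of_mem_separatedEvent {k J : ℕ} {δ : ℝ} {q : Fin d → Fin J} {ω : Sample d}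
    (h : ω ∈ separatedEvent k J δ q) :
    IsSeparated k δ ω.2 (cellIndex (blockIndex q (centre d))) := by
  intro u hu
  have hC : ∀ c, cellIndex (blockIndex q (centre d)) c =
      ((d : ℤ) + 2) + (blockSide d : ℤ) * (q c : ℕ) := by
    intro c
    rw [cellIndex_blockIndex]
    simp [centre]
  have hb : ∀ c, 0 ≤ u c - (blockSide d : ℤ) * (q c : ℕ) ∧
      u c - (blockSide d : ℤ) * (q c : ℕ) ≤ 2 * (d + 2) := by
    intro c
    have := abs_le.1 (hu c)
    rw [hC] at this
    constructor <;> linarith [this.1, this.2]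
  set o : Fin d → Fin (blockSide d) := fun c =>
    ⟨(u c - (blockSide d : ℤ) * (q c : ℕ)).toNat, by
      have h1 := hb c
      have h2 : (blockSide d : ℤ) = 2 * (d + 2) + 1 := by push_cast [blockSide]; ring
      omega⟩ with ho
  have hoc : ∀ c, ((o c : ℕ) : ℤ) = u c - (blockSide d : ℤ) * (q c : ℕ) := fun c =>
    Int.toNat_of_nonneg (hb c).1
  have hou : cellIndex (blockIndex q o) = u := by
    funext c
    rw [cellIndex_blockIndex, hoc]
    ring
  have hcond : (u = cellIndex (blockIndex q (centre d)) ∨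
      ∃ c, |u c - cellIndex (blockIndex q (centre d)) c| = d + 2) ↔
      (o = centre d ∨ ∃ c, (o c : ℕ) = 0 ∨ (o c : ℕ) = 2 * (d + 2)) := by
    refine or_congr ?_ (exists_congr fun c => ?_)
    · constructor
      · intro h1
        rw [← hou] at h1
        have h2 := cellIndex_injective h1
        exact (Prod.ext_iff.1 (blockIndex_injective (a₁ := (q, o)) (a₂ := (q, centre d)) h2)).2
      · intro h1
        rw [← hou, h1]
    · rw [hC, abs_eq (by positivity)]
      have := hoc c
      omega
  have h1 := h o
  rw [hou, admissible] at h1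
  by_cases hc : o = centre d ∨ ∃ c, (o c : ℕ) = 0 ∨ (o c : ℕ) = 2 * (d + 2)
  · rw [if_pos hc] at h1
    rw [if_pos (hcond.2 hc)]
    exact h1
  · rw [if_neg hc] at h1
    rw [if_neg (fun h2 => hc (hcond.1 h2))]
    exact h1

lemma measurableSet_separatedEvent (k J : ℕ) (δ : ℝ) (q : Fin d → Fin J) :
    MeasurableSet (separatedEvent k J δ q) := by
  refine MeasurableSpace.measurableSet_iInf.2 fun m => ?_
  have : Sigma.mk m ⁻¹' separatedEvent k J δ q =
      ⋂ o : Fin d → Fin (blockSide d), (fun p : Fin m → EuclideanSpace ℝ (Fin d) =>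
        count p (gridCube δ (cellIndex (blockIndex q o)))) ⁻¹' admissible d k o := by
    ext p
    simp [separatedEvent]
  change MeasurableSet (Sigma.mk m ⁻¹' separatedEvent k J δ q)
  rw [this]
  exact MeasurableSet.iInter fun o => measurable_count (measurableSet_box _ _) (.of_discrete)

/-- The probability that the centre of a block is separated, at intensity one per grid cube. -/
def separatedProb (d k : ℕ) : ℝ≥0∞ :=
  ∏ o : Fin d → Fin (blockSide d), poissonMeasure 1 (admissible d k o)

lemma separatedProb_ne_zero (d k : ℕ) : separatedProb d k ≠ 0 := by
  rw [separatedProb, Finset.prod_ne_zero_iff]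
  intro o _
  have hsing : ∀ j : ℕ, poissonMeasure 1 {j} ≠ 0 := by
    intro j h
    have := poissonMeasure_real_singleton_pos j (r := 1) one_pos
    rw [measureReal_def, h] at this
    simp at this
  rw [admissible]
  split_ifs
  · exact fun h => hsing (k + 1) (measure_mono_null (by simp) h)
  · exact hsing 0

lemma separatedProb_le_one (d k : ℕ) : separatedProb d k ≤ 1 :=
  Finset.prod_le_one' fun _ _ => prob_le_one

/-- Each grid cube has expected count one and distinct grid cubes have independent counts. The
product formula gives both the probability of a single event and the independence of the blocks. -/
lemma measure_biInter_separatedEvent (k : ℕ) {J : ℕ} {δ : ℝ} (hδ : 0 < δ)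
    (hJ : ((J * blockSide d : ℕ) : ℝ) * δ ≤ 1) {n : ℝ≥0} (hn : (n : ℝ) * δ ^ d = 1)
    (T : Finset (Fin d → Fin J)) :
    poissonLaw d n (⋂ q ∈ T, separatedEvent k J δ q) = separatedProb d k ^ T.card := by
  classical
  have hmeas : MeasurableSet (⋂ q ∈ T, separatedEvent k J δ q) :=
    T.measurableSet_biInter fun q _ => measurableSet_separatedEvent k J δ q
  set A : (Fin d → Fin J) × (Fin d → Fin (blockSide d)) → Set (EuclideanSpace ℝ (Fin d)) :=
    fun z => gridCube δ (cellIndex (blockIndex z.1 z.2)) with hA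
  set g : (Fin d → Fin J) × (Fin d → Fin (blockSide d)) → ℕ → ℝ≥0∞ :=
    fun z => (admissible d k z.2).indicator 1 with hg
  have hprod := poissonLintegral_prod_count (T ×ˢ Finset.univ) A
    (fun z _ => measurableSet_box _ _)
    (fun z _ w _ hzw => gridCube_disjoint hδ
      (cellIndex_injective.ne (blockIndex_injective.ne hzw))) g (n • cubeMeasure d)
  have hvol : ∀ z, ((n • cubeMeasure d) (A z)).toNNReal = 1 := by
    intro z
    have : cubeMeasure d (A z) = ENNReal.ofReal (δ ^ d) :=
      cubeMeasure_box hδ.le (gridCube_subset_box hδ.le hJ _)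
    rw [Measure.smul_apply, this, ENNReal.smul_def, smul_eq_mul, ← ENNReal.ofReal_coe_nnreal,
      ← ENNReal.ofReal_mul (by positivity), hn]
    simp
  have hint : ∀ z, ∫⁻ j, g z j ∂poissonMeasure 1 = poissonMeasure 1 (admissible d k z.2) :=
    fun z => lintegral_indicator_one .of_discrete
  simp only [hvol, hint] at hprod
  rw [Finset.prod_product] at hprod
  simp only [Finset.prod_const] at hprod
  rw [separatedProb, ← hprod, ← lintegral_indicator_one hmeas,
    lintegral_poissonLaw n (measurable_one.indicator hmeas)]
  congr 1
  funext m p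
  by_cases h : (⟨m, p⟩ : Sample d) ∈ ⋂ q ∈ T, separatedEvent k J δ q
  · rw [Set.indicator_of_mem h, Pi.one_apply, Finset.prod_eq_one]
    intro z hz
    rw [hg]
    simp only
    rw [Set.indicator_of_mem, Pi.one_apply]
    exact Set.mem_iInter₂.1 h z.1 (Finset.mem_product.1 hz).1 z.2
  · rw [Set.indicator_of_notMem h]
    simp only [Set.mem_iInter, separatedEvent, Set.mem_ofPred_eq, not_forall] at h
    obtain ⟨q, hq, o, ho⟩ := h
    refine (Finset.prod_eq_zero (i := (q, o)) (Finset.mem_product.2 ⟨hq, Finset.mem_univ o⟩) ?_).symm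
    rw [hg]
    simp only
    rw [Set.indicator_of_notMem ho]

open scoped Classical in
lemma card_separated_le_numComponents {k J : ℕ} {δ : ℝ} (hδ : 0 < δ) (ω : Sample d) :
    (∑ q : Fin d → Fin J, (separatedEvent k J δ q).indicator (fun _ => (1 : ℝ)) ω) ≤
      numComponents k ω := by
  have h : (∑ q : Fin d → Fin J, (separatedEvent k J δ q).indicator (fun _ => (1 : ℝ)) ω) =
      (Finset.univ.filter fun q : Fin d → Fin J => ω ∈ separatedEvent k J δ q).card := by
    simp [Set.indicator_apply]
  rw [h]
  have := card_isSeparated_le (k := k) hδ ω.2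
    (fun q : Fin d → Fin J => cellIndex (blockIndex q (centre d)))
    (fun q r hqr => (Prod.ext_iff.1 (blockIndex_injective (a₁ := (q, centre d))
      (a₂ := (r, centre d)) (cellIndex_injective hqr))).1)
    (Finset.univ.filter fun q : Fin d → Fin J => ω ∈ separatedEvent k J δ q)
    (fun q hq => isSeparated_of_mem_separatedEvent (Finset.mem_filter.1 hq).2)
  exact_mod_cast this

/-- The number of components is unlikely to be much smaller than the number of blocks. -/
lemma measure_numComponents_lt_le (k : ℕ) {J : ℕ} (hJ0 : 0 < J) {δ : ℝ} (hδ : 0 < δ)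
    (hJ : ((J * blockSide d : ℕ) : ℝ) * δ ≤ 1) {n : ℝ≥0} (hn : (n : ℝ) * δ ^ d = 1) :
    poissonLaw d n {ω | (numComponents k ω : ℝ) < J ^ d * (separatedProb d k).toReal / 2} ≤
      ENNReal.ofReal (1 / (J ^ d * (separatedProb d k).toReal ^ 2)) := by
  classical
  set P := poissonLaw d n with hP
  set p := (separatedProb d k).toReal with hp
  have hptop : separatedProb d k ≠ ⊤ := ((separatedProb_le_one d k).trans_lt ENNReal.one_lt_top).ne
  have hp0 : 0 < p := ENNReal.toReal_pos (separatedProb_ne_zero d k) hptop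
  set Z : (Fin d → Fin J) → Sample d → ℝ := fun q =>
    (separatedEvent k J δ q).indicator fun _ => (1 : ℝ) with hZ
  have hmeas : ∀ q : Fin d → Fin J, MeasurableSet (separatedEvent k J δ q) := fun q =>
    measurableSet_separatedEvent k J δ q
  have hprob : ∀ q : Fin d → Fin J, P (separatedEvent k J δ q) = separatedProb d k := by
    intro q
    have := measure_biInter_separatedEvent k hδ hJ hn {q}
    simpa using this
  have hindep : iIndepSet (fun q : Fin d → Fin J => separatedEvent k J δ q) P := by
    rw [iIndepSet_iff_meas_biInter hmeas]
    intro T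
    rw [measure_biInter_separatedEvent k hδ hJ hn T]
    simp [hprob]
  have hfun : iIndepFun Z P := hindep.iIndepFun_indicator
  have hL2 : ∀ q, MemLp (Z q) 2 P := fun q =>
    memLp_indicator_const 2 (hmeas q) 1 (Or.inr (measure_ne_top _ _))
  have hmean : ∀ q, ∫ ω, Z q ω ∂P = p := by
    intro q
    rw [hZ]
    simp only
    rw [integral_indicator_const _ (hmeas q), measureReal_def, hprob, smul_eq_mul, mul_one]
  have hvarZ : ∀ q, variance (Z q) P ≤ 1 / 4 := by
    intro q
    have := variance_le_sq_of_bounded (μ := P) (X := Z q) (a := 0) (b := 1)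
      (ae_of_all _ fun ω => by
        simp only [hZ, Set.indicator_apply]
        split_ifs <;> simp) (hL2 q).aestronglyMeasurable.aemeasurable
    norm_num at this ⊢
    exact this
  set N : Sample d → ℝ := ∑ q, Z q with hN
  have hNL2 : MemLp N 2 P := memLp_finsetSum' _ fun q _ => hL2 q
  have hcard : (Fintype.card (Fin d → Fin J) : ℝ) = J ^ d := by simp
  have hNmean : ∫ ω, N ω ∂P = J ^ d * p := by
    simp only [hN, Finset.sum_apply]
    rw [integral_finsetSum _ fun q _ => (hL2 q).integrable one_le_two]
    simp only [hmean]
    rw [Finset.sum_const, Finset.card_univ, nsmul_eq_mul, hcard]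
  have hNvar : variance N P ≤ J ^ d / 4 := by
    rw [hN, IndepFun.variance_sum (fun q _ => hL2 q)
      (fun q _ r _ hqr => hfun.indepFun hqr)]
    calc ∑ q, variance (Z q) P ≤ ∑ _q : Fin d → Fin J, (1 / 4 : ℝ) :=
          Finset.sum_le_sum fun q _ => hvarZ q
      _ = J ^ d / 4 := by
          rw [Finset.sum_const, Finset.card_univ, nsmul_eq_mul, hcard]; ring
  have hJd : (0 : ℝ) < J ^ d := by positivity
  -- Chebyshev's inequality at half the mean; variance at most `1 / 4` per block gives exactly `1 /
  -- (J ^ d * p ^ 2)`.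
  have hch := meas_ge_le_variance_div_sq hNL2 (c := J ^ d * p / 2) (by positivity)
  rw [hNmean] at hch
  calc P {ω | (numComponents k ω : ℝ) < J ^ d * p / 2}
      ≤ P {ω | J ^ d * p / 2 ≤ |N ω - J ^ d * p|} := by
        refine measure_mono fun ω hω => ?_
        have h1 : N ω ≤ numComponents k ω := by
          rw [hN, Finset.sum_apply]
          exact card_separated_le_numComponents hδ ω
        have h2 : (numComponents k ω : ℝ) < J ^ d * p / 2 := hω
        change J ^ d * p / 2 ≤ |N ω - J ^ d * p|
        exact le_abs.2 (Or.inr (by linarith))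
    _ ≤ ENNReal.ofReal (variance N P / (J ^ d * p / 2) ^ 2) := hch
    _ ≤ ENNReal.ofReal (1 / (J ^ d * p ^ 2)) := by
        refine ENNReal.ofReal_le_ofReal ?_
        rw [div_le_div_iff₀ (by positivity) (by positivity)]
        nlinarith [mul_le_mul_of_nonneg_right hNvar
          (by positivity : 0 ≤ (J : ℝ) ^ d * p ^ 2)]

/-- The number of components is of the order of the intensity with high probability. -/
lemma exists_measure_numComponents_lt_le (hd : 1 ≤ d) (k : ℕ) :
    ∃ c₁ > 0, ∃ c₂ > 0, ∃ n₀ : ℝ, 1 ≤ n₀ ∧ ∀ n : ℝ≥0, n₀ ≤ n →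
      (poissonLaw d n).real {ω | (numComponents k ω : ℝ) < c₁ * n} ≤ c₂ / n := by
  set p := (separatedProb d k).toReal with hp
  have hptop : separatedProb d k ≠ ⊤ := ((separatedProb_le_one d k).trans_lt ENNReal.one_lt_top).ne
  have hp0 : 0 < p := ENNReal.toReal_pos (separatedProb_ne_zero d k) hptop
  set W : ℝ := (blockSide d : ℝ) with hW
  have hW1 : 1 ≤ W := by
    rw [hW]; exact_mod_cast (by unfold blockSide; omega : 1 ≤ blockSide d)
  have hW0 : 0 < W := by linarith
  -- `n₀ = W ^ d` ensures that at least one block fits along each axis; both constants come from `J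
  -- ^ d ≥ n / (2 * W) ^ d`.
  refine ⟨p / (2 * (2 * W) ^ d), by positivity, (2 * W) ^ d / p ^ 2, by positivity, W ^ d,
    one_le_pow₀ hW1, fun n hn => ?_⟩
  have hn0 : (0 : ℝ) < n := lt_of_lt_of_le (by positivity) hn
  have hd0 : d ≠ 0 := by omega
  set y : ℝ := (n : ℝ) ^ (1 / (d : ℝ)) with hy
  have hy0 : 0 < y := by positivity
  have hyd : y ^ d = n := by
    rw [hy, ← Real.rpow_natCast, ← Real.rpow_mul hn0.le, one_div,
      inv_mul_cancel₀ (by exact_mod_cast hd0), Real.rpow_one]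
  have hWy : W ≤ y := by
    rw [← hyd] at hn
    exact le_of_pow_le_pow_left₀ hd0 hy0.le hn
  set J := ⌊y / W⌋₊ with hJ
  have hyW : 1 ≤ y / W := (one_le_div hW0).2 hWy
  have hJ1 : 1 ≤ J := Nat.le_floor (by exact_mod_cast hyW)
  have hJle : (J : ℝ) ≤ y / W := Nat.floor_le (by positivity)
  -- Rounding down a number that is at least `1` loses at most a factor `2`.
  have hJge : y / (2 * W) ≤ J := by
    have h1 : y / W < J + 1 := Nat.lt_floor_add_one _
    have h2 : (1 : ℝ) ≤ J := by exact_mod_cast hJ1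
    have h3 : y / (2 * W) = y / W / 2 := by field_simp
    rw [h3]
    linarith
  have hJd : n / (2 * W) ^ d ≤ (J : ℝ) ^ d := by
    rw [← hyd, ← div_pow]
    exact pow_le_pow_left₀ (by positivity) hJge d
  have hmain := measure_numComponents_lt_le (d := d) k (J := J) hJ1 (inv_pos.2 hy0) (by
    push_cast [← hW]
    rw [← div_eq_mul_inv, div_le_one hy0]
    rwa [le_div_iff₀ hW0] at hJle) (n := n) (by rw [inv_pow, hyd]; field_simp)
  have hJ0 : (0 : ℝ) < (J : ℝ) ^ d := by positivity
  rw [measureReal_def]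
  refine ENNReal.toReal_le_of_le_ofReal (by positivity)
    ((measure_mono fun ω hω => ?_).trans (hmain.trans (ENNReal.ofReal_le_ofReal ?_)))
  · have h1 : (numComponents k ω : ℝ) < p / (2 * (2 * W) ^ d) * n := hω
    refine h1.trans_le ?_
    have h2 : p / (2 * (2 * W) ^ d) * n = n / (2 * W) ^ d * p / 2 := by field_simp
    rw [h2]
    gcongr
  · have h2 : (2 * W) ^ d / p ^ 2 / n = 1 / (n / (2 * W) ^ d * p ^ 2) := by field_simp
    rw [h2]
    gcongr

end Concentration

/-! ### Diameter bounds and positivity of the limit -/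

section Diameter

variable {d : ℕ}

lemma integrable_sumDiam (k : ℕ) (n : ℝ≥0) :
    Integrable (fun ω : Sample d => sumDiam k ω) (poissonLaw d n) := by
  refine ((integrable_numComponents k n).const_mul √d).mono'
    (measurable_sumDiam k).aestronglyMeasurable ?_
  filter_upwards [ae_mem_cube n] with ω hω
  rw [Real.norm_of_nonneg (sumDiam_nonneg k ω)]
  exact sumDiam_le_mul_numComponents k ω hω

lemma integrable_meanDiam (k : ℕ) (n : ℝ≥0) :
    Integrable (fun ω : Sample d => meanDiam k ω) (poissonLaw d n) := by
  refine (integrable_const (√d : ℝ)).mono' (measurable_meanDiam k).aestronglyMeasurable ?_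
  filter_upwards [ae_mem_cube n] with ω hω
  rw [Real.norm_of_nonneg (meanDiam_nonneg k ω)]
  exact meanDiam_le k ω hω

lemma rpow_neg_one_div_pow (hd : 1 ≤ d) {n : ℝ} (hn : 0 < n) : (n ^ (-(1 : ℝ) / d)) ^ d = n⁻¹ := by
  rw [← Real.rpow_natCast, ← Real.rpow_mul hn.le,
    div_mul_cancel₀ _ (by exact_mod_cast (by omega : d ≠ 0)), Real.rpow_neg_one]

/-- With the threshold `r = n ^ (-1 / d)` one has `r / r ^ d = n * r`, so both terms of `sumDiam_le`
have the same order. -/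
lemma integral_sumDiam_le (hd : 1 ≤ d) {k : ℕ} (hk : 1 ≤ k) {n : ℝ≥0} (hn : 0 < n) :
    ∫ ω : Sample d, sumDiam k ω ∂poissonLaw d n ≤
      2 * (1 + k * (4 * √d) ^ d) * (n * (n : ℝ) ^ (-(1 : ℝ) / d)) := by
  have hn0 : (0 : ℝ) < n := hn
  set r : ℝ := (n : ℝ) ^ (-(1 : ℝ) / d) with hr
  have hr0 : 0 < r := by positivity
  have hrd : r / r ^ d = n * r := by
    rw [hr, rpow_neg_one_div_pow hd hn0, ← hr]; field_simp
  calc ∫ ω : Sample d, sumDiam k ω ∂poissonLaw d n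
      ≤ ∫ ω : Sample d, (2 * r * ω.1 + 2 * (k * (4 * √d) ^ d * (n * r))) ∂poissonLaw d n := by
        refine integral_mono_ae (integrable_sumDiam k n)
          (((integrable_card n).const_mul _).add (integrable_const _)) ?_
        filter_upwards [ae_mem_cube n] with ω hω
        have := sumDiam_le hd hk ω hω hr0
        rw [hrd] at this
        refine this.trans_eq ?_
        ring
    _ = 2 * (1 + k * (4 * √d) ^ d) * (n * r) := by
        rw [integral_add ((integrable_card n).const_mul _) (integrable_const _),
          integral_const_mul, integral_card, integral_const]
        simp only [probReal_univ, one_smul]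
        ring

/-- Markov's inequality, used to turn the tail bound into a lower bound on the mean. -/
lemma integral_numComponents_ge (k : ℕ) (n : ℝ≥0) {a : ℝ} (ha : 0 ≤ a) {ε : ℝ}
    (h : (poissonLaw d n).real {ω | (numComponents k ω : ℝ) < a} ≤ ε) :
    a * (1 - ε) ≤ ∫ ω : Sample d, (numComponents k ω : ℝ) ∂poissonLaw d n := by
  have h1 := mul_meas_ge_le_integral_of_nonneg (μ := poissonLaw d n)
    (f := fun ω : Sample d => (numComponents k ω : ℝ)) (ae_of_all _ fun ω => Nat.cast_nonneg _)
    (integrable_numComponents k n) a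
  have hm : MeasurableSet {ω : Sample d | (numComponents k ω : ℝ) < a} :=
    measurableSet_lt (measurable_from_nat.comp (measurable_numComponents k)) measurable_const
  have h2 : (poissonLaw d n).real {ω | a ≤ (numComponents k ω : ℝ)} =
      1 - (poissonLaw d n).real {ω | (numComponents k ω : ℝ) < a} := by
    rw [← probReal_compl_eq_one_sub hm]
    congr 1
    ext ω
    simp
  rw [h2] at h1
  refine le_trans ?_ h1
  gcongr

/-- Where there are at least `a` components, dividing by `a` only increases the quotient; elsewhere
the diameter of the cube is the bound. -/
lemma integral_meanDiam_le (k : ℕ) (n : ℝ≥0) {a : ℝ} (ha : 0 < a) :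
    ∫ ω : Sample d, meanDiam k ω ∂poissonLaw d n ≤
      (∫ ω : Sample d, sumDiam k ω ∂poissonLaw d n) / a +
        √d * (poissonLaw d n).real {ω | (numComponents k ω : ℝ) < a} := by
  set D : Set (Sample d) := {ω | (numComponents k ω : ℝ) < a} with hD
  have hm : MeasurableSet D :=
    measurableSet_lt (measurable_from_nat.comp (measurable_numComponents k)) measurable_const
  have hint : Integrable (D.indicator fun _ => (√d : ℝ)) (poissonLaw d n) :=
    (integrable_const _).indicator hm
  calc ∫ ω : Sample d, meanDiam k ω ∂poissonLaw d n
      ≤ ∫ ω : Sample d, (sumDiam k ω / a + D.indicator (fun _ => (√d : ℝ)) ω)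
          ∂poissonLaw d n := by
        refine integral_mono_ae (integrable_meanDiam k n)
          (((integrable_sumDiam k n).div_const a).add hint) ?_
        filter_upwards [ae_mem_cube n] with ω hω
        have h0 := sumDiam_nonneg k ω
        by_cases hmem : ω ∈ D
        · rw [Set.indicator_of_mem hmem]
          have h1 := meanDiam_le k ω hω
          have h2 : 0 ≤ sumDiam k ω / a := by positivity
          linarith
        · rw [Set.indicator_of_notMem hmem, add_zero]
          have h1 : a ≤ numComponents k ω := not_lt.1 hmem
          exact div_le_div_of_nonneg_left h0 ha h1
    _ = _ := by
        rw [integral_add ((integrable_sumDiam k n).div_const a) hint, integral_div,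
          integral_indicator_const _ hm, smul_eq_mul, mul_comm √(d : ℝ)]

lemma integral_meanDiam_le_sqrt (k : ℕ) (n : ℝ≥0) :
    ∫ ω : Sample d, meanDiam k ω ∂poissonLaw d n ≤ √d := by
  calc ∫ ω : Sample d, meanDiam k ω ∂poissonLaw d n
      ≤ ∫ _ω : Sample d, (√d : ℝ) ∂poissonLaw d n := by
        refine integral_mono_ae (integrable_meanDiam k n) (integrable_const _) ?_
        filter_upwards [ae_mem_cube n] with ω hω
        exact meanDiam_le k ω hω
    _ = √d := by simp

lemma integral_sumDiam_div_le_sqrt (k : ℕ) (n : ℝ≥0) :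
    (∫ ω : Sample d, sumDiam k ω ∂poissonLaw d n) /
      (∫ ω : Sample d, (numComponents k ω : ℝ) ∂poissonLaw d n) ≤ √d := by
  refine div_le_of_le_mul₀ (integral_nonneg fun ω => Nat.cast_nonneg _) (Real.sqrt_nonneg _) ?_
  rw [← integral_const_mul]
  refine integral_mono_ae (integrable_sumDiam k n) ((integrable_numComponents k n).const_mul _) ?_
  filter_upwards [ae_mem_cube n] with ω hω
  exact sumDiam_le_mul_numComponents k ω hω

/-- For bounded intensities the diameter of the cube already has the required form. -/
lemma sqrt_le_mul_rpow {n₁ n : ℝ} (hn : 0 < n) (hn₁ : n ≤ n₁) :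
    √d ≤ √d * n₁ ^ (1 / (d : ℝ)) * n ^ (-(1 : ℝ) / d) := by
  have h1 : n ^ (1 / (d : ℝ)) * n ^ (-(1 : ℝ) / d) = 1 := by
    rw [← Real.rpow_add hn, ← add_div, add_neg_cancel, zero_div, Real.rpow_zero]
  have h2 : n ^ (1 / (d : ℝ)) ≤ n₁ ^ (1 / (d : ℝ)) :=
    Real.rpow_le_rpow hn.le hn₁ (by positivity)
  calc √(d : ℝ) = √d * (n ^ (1 / (d : ℝ)) * n ^ (-(1 : ℝ) / d)) := by rw [h1, mul_one]
    _ ≤ √d * (n₁ ^ (1 / (d : ℝ)) * n ^ (-(1 : ℝ) / d)) := by gcongr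
    _ = _ := by ring

lemma exists_diam_bound (hd : 1 ≤ d) {k : ℕ} (hk : 1 ≤ k) :
    ∃ C : ℝ, 0 < C ∧ ∀ n : ℝ≥0, 0 < n →
      ∫ ω : Sample d, meanDiam k ω ∂poissonLaw d n ≤ C * (n : ℝ) ^ (-(1 : ℝ) / d) ∧
      (∫ ω : Sample d, sumDiam k ω ∂poissonLaw d n) /
          (∫ ω : Sample d, (numComponents k ω : ℝ) ∂poissonLaw d n) ≤
        C * (n : ℝ) ^ (-(1 : ℝ) / d) := by
  obtain ⟨c₁, hc₁, c₂, hc₂, n₀, hn₀, hprob⟩ := exists_measure_numComponents_lt_le hd k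
  -- Beyond `n₁` the exceptional event has probability at most `1 / 2`, so the expected number of
  -- components is at least `c₁ * n / 2`. `C₁` serves the intensities up to `n₁`, `C₂` and `C₃` the
  -- two mean diameters beyond; their sum serves all cases.
  set n₁ : ℝ := n₀ + 2 * c₂ with hn₁
  have hn₁0 : 0 < n₁ := by positivity
  set S : ℝ := 2 * (1 + k * (4 * √d) ^ d) with hS
  have hS0 : 0 < S := by positivity
  set C₁ : ℝ := √d * n₁ ^ (1 / (d : ℝ)) with hC₁
  have hC₁0 : 0 ≤ C₁ := by positivity
  set C₂ : ℝ := S / c₁ + √d * c₂ with hC₂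
  have hC₂0 : 0 < C₂ := by positivity
  set C₃ : ℝ := 2 * S / c₁ with hC₃
  have hC₃0 : 0 < C₃ := by positivity
  refine ⟨C₁ + C₂ + C₃, by positivity, fun n hn => ?_⟩
  have hnr : (0 : ℝ) < n := hn
  set r : ℝ := (n : ℝ) ^ (-(1 : ℝ) / d) with hr
  have hr0 : 0 < r := by positivity
  have hexpand : (C₁ + C₂ + C₃) * r = C₁ * r + C₂ * r + C₃ * r := by ring
  have h1 : 0 ≤ C₁ * r := by positivity
  have h2 : 0 ≤ C₂ * r := by positivity
  have h3 : 0 ≤ C₃ * r := by positivity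
  rw [hexpand]
  rcases le_total (n : ℝ) n₁ with hle | hge
  · have h4 : √d ≤ C₁ * r := sqrt_le_mul_rpow hnr hle
    have h5 := integral_meanDiam_le_sqrt (d := d) k n
    have h6 := integral_sumDiam_div_le_sqrt (d := d) k n
    constructor <;> linarith
  · have hP := hprob n (by linarith)
    have hsum : ∫ ω : Sample d, sumDiam k ω ∂poissonLaw d n ≤ S * (n * r) :=
      integral_sumDiam_le hd hk hn
    have hc₂n : c₂ / n ≤ 1 / 2 := by
      rw [div_le_div_iff₀ hnr two_pos]; linarith
    have hX : c₁ * n / 2 ≤ ∫ ω : Sample d, (numComponents k ω : ℝ) ∂poissonLaw d n := by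
      refine le_trans ?_ (integral_numComponents_ge k n (by positivity) hP)
      have : 0 < c₁ * n := by positivity
      nlinarith
    constructor
    · have h4 := integral_meanDiam_le (d := d) k n (a := c₁ * n) (by positivity)
      have h5 : (∫ ω : Sample d, sumDiam k ω ∂poissonLaw d n) / (c₁ * n) ≤ S / c₁ * r := by
        rw [div_le_iff₀ (by positivity)]
        refine hsum.trans_eq ?_
        field_simp
      -- Since `n ≥ 1` and `d ≥ 1`, the cost of order `1 / n` of the exceptional event is within the
      -- rate.
      have h6 : (n : ℝ)⁻¹ ≤ r := by
        rw [hr, ← Real.rpow_neg_one]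
        refine Real.rpow_le_rpow_of_exponent_le (by linarith) ?_
        rw [neg_div, neg_le_neg_iff]
        exact (div_le_one (by exact_mod_cast hd)).2 (by exact_mod_cast hd)
      have h7 : √d * (poissonLaw d n).real {ω | (numComponents k ω : ℝ) < c₁ * n} ≤
          √d * c₂ * r := by
        rw [mul_assoc]
        refine mul_le_mul_of_nonneg_left (hP.trans ?_) (Real.sqrt_nonneg _)
        rw [div_eq_mul_inv]
        exact mul_le_mul_of_nonneg_left h6 hc₂.le
      have h8 : C₂ * r = S / c₁ * r + √d * c₂ * r := by rw [hC₂]; ring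
      linarith
    · have h4 : (∫ ω : Sample d, sumDiam k ω ∂poissonLaw d n) /
          (∫ ω : Sample d, (numComponents k ω : ℝ) ∂poissonLaw d n) ≤ C₃ * r := by
        have hXpos : 0 < c₁ * n / 2 := by positivity
        rw [div_le_iff₀ (hXpos.trans_le hX)]
        refine hsum.trans (le_trans (le_of_eq ?_)
          (mul_le_mul_of_nonneg_left hX (by positivity)))
        rw [hC₃]
        field_simp
      linarith

/-- The limit is at least `c₁ / 2`, because for large intensities the probability of fewer than `c₁
* n` components is at most `1 / 2`. -/
lemma exists_pos_tendsto (hd : 1 ≤ d) (k : ℕ) :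
    ∃ c : ℝ, 0 < c ∧
      Tendsto (fun n : ℝ≥0 => (∫ ω : Sample d, (numComponents k ω : ℝ) ∂poissonLaw d n) / n)
        atTop (𝓝 c) := by
  obtain ⟨c₁, hc₁, c₂, hc₂, n₀, hn₀, hprob⟩ := exists_measure_numComponents_lt_le hd k
  obtain ⟨c, hc⟩ := exists_tendsto_expComponents_div hd k
  simp only [integral_numComponents]
  refine ⟨c, ?_, hc⟩
  have hge : ∀ᶠ n : ℝ≥0 in atTop, c₁ / 2 ≤ (expComponents d k n).toReal / n := by
    filter_upwards [eventually_ge_atTop (⟨n₀ + 2 * c₂, by positivity⟩ : ℝ≥0)] with n hn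
    have hn' : n₀ + 2 * c₂ ≤ (n : ℝ) := hn
    have hnr : (0 : ℝ) < n := by linarith
    have hc₂n : c₂ / n ≤ 1 / 2 := by
      rw [div_le_div_iff₀ hnr two_pos]; linarith
    rw [← integral_numComponents, le_div_iff₀ hnr]
    refine le_trans ?_ (integral_numComponents_ge k n (by positivity) (hprob n (by linarith)))
    have : 0 < c₁ * n := by positivity
    nlinarith
  exact (half_pos hc₁).trans_le (ge_of_tendsto hc hge)

end Diameter

end KNN

end

theorem theorem1 (d k : ℕ) (hd : 1 ≤ d) (hk : 1 ≤ k) :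
    ((∀ n : ℝ≥0, 0 < n →
        Integrable (fun ω => (KNN.numComponents k ω : ℝ)) (KNN.poissonLaw d n)) ∧
      ∃ c : ℝ, 0 < c ∧
        Tendsto (fun n : ℝ≥0 => (∫ ω, (KNN.numComponents k ω : ℝ) ∂KNN.poissonLaw d n) / n)
          atTop (𝓝 c)) ∧
    ∃ C : ℝ, 0 < C ∧ ∀ n : ℝ≥0, 0 < n →
      (Integrable (fun ω => KNN.meanDiam k ω) (KNN.poissonLaw d n) ∧
        ∫ ω, KNN.meanDiam k ω ∂KNN.poissonLaw d n ≤ C * (n : ℝ) ^ (-(1 : ℝ) / d)) ∧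
      (Integrable (fun ω => KNN.sumDiam k ω) (KNN.poissonLaw d n) ∧
        (∫ ω, KNN.sumDiam k ω ∂KNN.poissonLaw d n) /
            (∫ ω, (KNN.numComponents k ω : ℝ) ∂KNN.poissonLaw d n) ≤
          C * (n : ℝ) ^ (-(1 : ℝ) / d)) := by
  obtain ⟨C, hC, hbound⟩ := KNN.exists_diam_bound hd hk
  exact ⟨⟨fun n _ => KNN.integrable_numComponents k n, KNN.exists_pos_tendsto hd k⟩,
    C, hC, fun n hn => ⟨⟨KNN.integrable_meanDiam k n, (hbound n hn).1⟩,
      KNN.integrable_sumDiam k n, (hbound n hn).2⟩⟩
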